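/- All graphs are finite and simple; a graph is planar if it can be drawn in the plane without crossings, and an acyclic graph has infinite girth. For an integer $k\ge 3$, a graph is $C_k$-colorable if it admits a homomorphism to the cycle $C_k$ of length $k$, and $f(k)$ denotes the smallest integer $m\ge 0$ such that every planar graph of girth exactly $k$ without cycles of length from $k+1$ to $m$ is $C_k$-colorable ($f(k)=\infty$ if there is no such $m$). For positive integers $k\ge 2d$, a circular $(k,d)$-coloring of a graph $G$ is a map $\varphi:V(G)\to\{0,1,\dots,k-1\}$ with $d\le|\varphi(u)-\varphi(v)|\le k-d$ for every edge $uv$, and the circular chromatic number $\chi_c(G)$ is the infimum of the ratios $k/d$ over all such pairs $(k,d)$ for which $G$ has a circular $(k,d)$-coloring. Let $p\ge 5$ be a prime. If $f(p)\le p(p-2)$, then every planar graph $G$ of girth at least $2p-2$ is $C_p$-colorable; in particular $\chi_c(G)\le 2+\frac{2}{p-1}$. -/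

import Mathlib

namespace SteinbergCircular

/-- `A` is a simple polygonal arc in the plane from `x` to `y`: a chain of `n ≥ 1` nondegenerate
straight segments `[q 0, q 1], …, [q (n-1), q n]` with `q 0 = x`, `q n = y`, in which consecutive
segments meet only in their common end and other pairs of segments are disjoint. -/
def IsPolygonalArc (A : Set (ℝ × ℝ)) (x y : ℝ × ℝ) : Prop :=
  ∃ (n : ℕ) (q : ℕ → ℝ × ℝ),
    0 < n ∧ q 0 = x ∧ q n = y ∧
    A = ⋃ i ∈ Finset.range n, segment ℝ (q i) (q (i + 1)) ∧
    (∀ i, i < n → q i ≠ q (i + 1)) ∧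
    (∀ i, i + 1 < n →
      segment ℝ (q i) (q (i + 1)) ∩ segment ℝ (q (i + 1)) (q (i + 2)) = {q (i + 1)}) ∧
    (∀ i j, i + 1 < j → j < n →
      Disjoint (segment ℝ (q i) (q (i + 1))) (segment ℝ (q j) (q (j + 1))))

/-- A drawing of `G` in the plane without crossings: vertices are distinct points, every edge is a
simple polygonal arc joining its two ends and passing through no other vertex, and
two different edges meet only in common ends. -/
structure PlaneDrawing {V : Type*} (G : SimpleGraph V) where
  /-- the point that represents a vertex -/
  pt : V → ℝ × ℝ
  /-- the arc that represents an edge (irrelevant on pairs that are not edges) -/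
  arc : Sym2 V → Set (ℝ × ℝ)
  pt_injective : Function.Injective pt
  isPolygonalArc : ∀ u v, G.Adj u v → IsPolygonalArc (arc s(u, v)) (pt u) (pt v)
  mem_of_pt_mem : ∀ e ∈ G.edgeSet, ∀ w, pt w ∈ arc e → w ∈ e
  inter_subset : ∀ e ∈ G.edgeSet, ∀ f ∈ G.edgeSet, e ≠ f →
    ∀ z ∈ arc e ∩ arc f, ∃ w, w ∈ e ∧ w ∈ f ∧ pt w = z

/-- A graph is planar if it can be drawn in the plane without crossings. -/
def IsPlanar {V : Type*} (G : SimpleGraph V) : Prop :=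
  Nonempty (PlaneDrawing G)

/-- `G` is `C_k`-colorable: it admits a homomorphism to the cycle of length `k`. -/
def CycleColorable {V : Type*} (G : SimpleGraph V) (k : ℕ) : Prop :=
  Nonempty (G →g SimpleGraph.cycleGraph k)

/-- `G` has no cycle whose length lies in `{a, a + 1, …, b}`. -/
def NoCycleOfLength {V : Type*} (G : SimpleGraph V) (a b : ℕ) : Prop :=
  ∀ (v : V) (c : G.Walk v v), c.IsCycle → ¬ (a ≤ c.length ∧ c.length ≤ b)

/-- Every finite planar graph of girth `k` without cycles of length from `k + 1` to `m` is
`C_k`-colorable. -/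
def IsSteinbergBound (k m : ℕ) : Prop :=
  ∀ (V : Type) [Finite V] (G : SimpleGraph V), IsPlanar G → G.egirth = (k : ℕ∞) →
    NoCycleOfLength G (k + 1) m → CycleColorable G k

/-- `f k` is the smallest `m` such that every finite planar graph of girth `k` without cycles of
length from `k + 1` to `m` is `C_k`-colorable, and `⊤` if there is no such `m`. -/
noncomputable def f (k : ℕ) : ℕ∞ :=
  ⨅ (m : ℕ) (_ : IsSteinbergBound k m), (m : ℕ∞)

/-- `G` has a circular `(k, d)`-coloring. -/
def HasCircularColoring {V : Type*} (G : SimpleGraph V) (k d : ℕ) : Prop :=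
  ∃ φ : V → Fin k, ∀ u v, G.Adj u v →
    (d : ℤ) ≤ |(φ u : ℤ) - (φ v : ℤ)| ∧ |(φ u : ℤ) - (φ v : ℤ)| ≤ (k : ℤ) - (d : ℤ)

/-- The circular chromatic number: the infimum of the ratios `k / d` over all positive integers
`k ≥ 2 d` for which `G` has a circular `(k, d)`-coloring. -/
noncomputable def circularChromaticNumber {V : Type*} (G : SimpleGraph V) : ℝ :=
  sInf {r : ℝ | ∃ k d : ℕ, 0 < d ∧ 2 * d ≤ k ∧ HasCircularColoring G k d ∧ r = (k : ℝ) / (d : ℝ)}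

end SteinbergCircular

namespace SteinbergCircular

open Filter Topology

/-! ### Segments in the plane -/

/-! Write `p = 2 * a + 1`, so that `G` has girth at least `4 * a`. Replace every edge of `G` by two
internally disjoint paths of lengths `a` and `a + 1` with the same ends, that is, by a cycle of
length `p`. The new graph `H` is planar. A cycle of `H` that uses both paths of some edge is that
`p`-cycle; any other cycle runs through at most one path per edge, the edges of `G` that it meets
contain a cycle of `G`, and so its length is at least `4 * a * a` (`length_eq_or_le_length`). Since
`p * (p - 2) = 4 * a * a - 1`, if `G` has an edge then `H` has girth exactly `p` and no cycle length
that the bound on `f p` forbids, hence `H` is `C_p`-colorable.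

In such a coloring the two paths force the ends of an edge of `G` to differ by `a` or `-a` modulo
`p`. As `-2 * a = 1` modulo `p`, multiplying the colors by `-2` gives a `C_p`-coloring of `G`
(`cycleColorable_of_oddReplacement`); multiplying a `C_p`-coloring by `a` gives a circular `(p,
a)`-coloring, and `p / a = 2 + 2 / (p - 1)`.

Most of the work is planarity of `H`, proved with polygonal arcs. Each edge is doubled by shifting
the inner vertices of its arc slightly to the left (`PlaneDrawing.exists_doubled`), and the
resulting multigraph drawing is then subdivided (`IsMultiDrawing.isPlanar_subdivision`). All
conditions on a drawing are open in the positions of the vertices of the arcs, except that a shifted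
arc meets its original only at the ends; this last condition is checked by the sign of cross
products. -/

/-- The two-dimensional cross product. -/
def cross (u v : ℝ × ℝ) : ℝ := u.1 * v.2 - u.2 * v.1

/-- The dot product in the plane. -/
def dot (u v : ℝ × ℝ) : ℝ := u.1 * v.1 + u.2 * v.2

theorem continuous_cross : Continuous fun z : (ℝ × ℝ) × (ℝ × ℝ) => cross z.1 z.2 := by
  unfold cross; fun_prop

theorem continuous_dot : Continuous fun z : (ℝ × ℝ) × (ℝ × ℝ) => dot z.1 z.2 := by
  unfold dot; fun_prop

theorem dot_self_pos {u : ℝ × ℝ} (hu : u ≠ 0) : 0 < dot u u := by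
  rcases u with ⟨a, b⟩
  have : a ≠ 0 ∨ b ≠ 0 := by
    by_contra! h
    exact hu (by simp [h.1, h.2])
  simp only [dot]
  rcases this with h | h
  · nlinarith [mul_self_pos.2 h, mul_self_nonneg b]
  · nlinarith [mul_self_pos.2 h, mul_self_nonneg a]

/-- Points of a segment in coordinates. -/
theorem mem_segment_iff_param {a b z : ℝ × ℝ} :
    z ∈ segment ℝ a b ↔ ∃ s : ℝ, 0 ≤ s ∧ s ≤ 1 ∧ z = (1 - s) • a + s • b := by
  rw [segment_eq_image]
  constructor
  · rintro ⟨s, hs, rfl⟩; exact ⟨s, hs.1, hs.2, rfl⟩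
  · rintro ⟨s, h0, h1, rfl⟩; exact ⟨s, ⟨h0, h1⟩, rfl⟩

/-- Disjointness of segments is stable under perturbation of their ends. -/
theorem eventually_disjoint_segment {ι : Type*} {l : Filter ι} {a b c d : ι → ℝ × ℝ}
    {a₀ b₀ c₀ d₀ : ℝ × ℝ} (ha : Tendsto a l (𝓝 a₀)) (hb : Tendsto b l (𝓝 b₀))
    (hc : Tendsto c l (𝓝 c₀)) (hd : Tendsto d l (𝓝 d₀))
    (h : Disjoint (segment ℝ a₀ b₀) (segment ℝ c₀ d₀)) :
    ∀ᶠ t in l, Disjoint (segment ℝ (a t) (b t)) (segment ℝ (c t) (d t)) := by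
  have hcomp : ∀ x y : ℝ × ℝ, IsCompact (segment ℝ x y) := fun x y => by
    rw [segment_eq_image_lineMap]
    exact isCompact_Icc.image AffineMap.lineMap_continuous
  -- A linear functional separates the two compact segments strictly. By convexity it suffices to
  -- keep the four ends on their sides, which is an open condition.
  obtain ⟨f, u, v, h1, huv, h2⟩ := geometric_hahn_banach_compact_closed (convex_segment a₀ b₀)
    (hcomp _ _) (convex_segment c₀ d₀) (hcomp _ _).isClosed h
  have key : ∀ {x : ι → ℝ × ℝ} {x₀}, Tendsto x l (𝓝 x₀) →
      Tendsto (fun t => f (x t)) l (𝓝 (f x₀)) := fun hx => (f.continuous.tendsto _).comp hx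
  filter_upwards [(key ha).eventually_lt_const (h1 _ (left_mem_segment ℝ _ _)),
    (key hb).eventually_lt_const (h1 _ (right_mem_segment ℝ _ _)),
    (key hc).eventually_const_lt (h2 _ (left_mem_segment ℝ _ _)),
    (key hd).eventually_const_lt (h2 _ (right_mem_segment ℝ _ _))] with t ta tb tc td
  rw [Set.disjoint_left]
  intro z hz hz'
  have e1 : z ∈ {x | f x < u} :=
    (convex_halfSpace_lt f.toLinearMap.isLinear u).segment_subset ta tb hz
  have e2 : z ∈ {x | v < f x} :=
    (convex_halfSpace_gt f.toLinearMap.isLinear v).segment_subset tc td hz'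
  simp only [Set.mem_ofPred_eq] at e1 e2
  linarith

/-- Parallel vectors with nonnegative dot product point the same way, so the two segments would
share an initial piece. Together with `segment_inter_subset_of_cross_or_dot` this turns meeting only
in the common end into an open condition. -/
theorem cross_ne_zero_or_dot_neg {a b c : ℝ × ℝ} (hb : a ≠ b) (hc : a ≠ c)
    (h : segment ℝ a b ∩ segment ℝ a c ⊆ {a}) :
    cross (b - a) (c - a) ≠ 0 ∨ dot (b - a) (c - a) < 0 := by
  by_contra! hcon
  obtain ⟨h0, hd⟩ := hcon
  set u := b - a with hu
  set v := c - a with hv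
  have hb' : b = a + u := by simp [hu]
  have hc' : c = a + v := by simp [hv]
  have hu0 : u ≠ 0 := fun h => hb (by simpa [h] using hb'.symm)
  have hv0 : v ≠ 0 := fun h => hc (by simpa [h] using hc'.symm)
  have hpu := dot_self_pos hu0
  have hpv := dot_self_pos hv0
  -- Dividing by `m` keeps both parameters at most 1: the common point is `a + (dot u v / m) • u = a
  -- + (dot u u / m) • v`.
  set m := dot u u + dot v v
  have hm : 0 < m := by positivity
  have hle : ∀ x y : ℝ × ℝ, dot x y ≤ dot x x + dot y y := fun x y => by
    simp only [dot]; nlinarith [sq_nonneg (x.1 - y.1), sq_nonneg (x.2 - y.2),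
      sq_nonneg (x.1 + y.1), sq_nonneg (x.2 + y.2)]
  have hrel : (dot u v) • u = (dot u u) • v := by
    simp only [cross] at h0
    ext
    · simp only [dot, Prod.smul_fst, smul_eq_mul]; linear_combination (u.2) * h0
    · simp only [dot, Prod.smul_snd, smul_eq_mul]; linear_combination (-u.1) * h0
  have hdpos : 0 < dot u v := by
    rcases hd.lt_or_eq with h | h
    · exact h
    · rw [← h, zero_smul] at hrel
      exact absurd hrel.symm (smul_ne_zero hpu.ne' hv0)
  have hz : a + (dot u v / m) • u ∈ segment ℝ a b ∩ segment ℝ a c := by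
    constructor
    · rw [mem_segment_iff_param]
      refine ⟨dot u v / m, by positivity, ?_, ?_⟩
      · rw [div_le_one hm]; exact hle u v
      · rw [hb']; module
    · rw [mem_segment_iff_param]
      refine ⟨dot u u / m, by positivity, ?_, ?_⟩
      · rw [div_le_one hm]; exact le_add_of_nonneg_right hpv.le
      · have : (dot u v / m) • u = (dot u u / m) • v := by
          rw [div_eq_inv_mul, mul_smul, hrel, ← mul_smul, ← div_eq_inv_mul]
        rw [this, hc']; module
  have := h hz
  simp only [Set.mem_singleton_iff, add_eq_left] at this
  exact smul_ne_zero (div_pos hdpos hm).ne' hu0 this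

/-- A second common point gives `s • (b - a) = r • (c - a)` with `s, r > 0`, hence parallel vectors
with positive dot product. -/
theorem segment_inter_subset_of_cross_or_dot {a b c : ℝ × ℝ}
    (h : cross (b - a) (c - a) ≠ 0 ∨ dot (b - a) (c - a) < 0) :
    segment ℝ a b ∩ segment ℝ a c ⊆ {a} := by
  rintro z ⟨hz1, hz2⟩
  obtain ⟨s, hs0, -, rfl⟩ := mem_segment_iff_param.1 hz1
  obtain ⟨r, hr0, -, hr⟩ := mem_segment_iff_param.1 hz2
  have e : s • (b - a) = r • (c - a) := by
    have : (1 - s) • a + s • b - a = (1 - r) • a + r • c - a := by rw [hr]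
    calc s • (b - a) = (1 - s) • a + s • b - a := by module
      _ = (1 - r) • a + r • c - a := this
      _ = r • (c - a) := by module
  have e1 := congrArg Prod.fst e
  have e2 := congrArg Prod.snd e
  simp only [Prod.smul_fst, Prod.smul_snd, smul_eq_mul] at e1 e2
  have hsr : s = 0 ∨ r = 0 := by
    by_contra! hcon
    have hsp : 0 < s := lt_of_le_of_ne hs0 hcon.1.symm
    have hrp : 0 < r := lt_of_le_of_ne hr0 hcon.2.symm
    rcases h with h | h
    · apply h
      have : s * r * cross (b - a) (c - a) = 0 := by
        simp only [cross]
        linear_combination (r * (c - a).2) * e1 - (r * (c - a).1) * e2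
      exact (mul_eq_zero.1 this).resolve_left (mul_pos hsp hrp).ne'
    · have h1 : s * r * dot (b - a) (c - a) = (s * (b - a).1) ^ 2 + (s * (b - a).2) ^ 2 := by
        simp only [dot]
        linear_combination (-(s * (b - a).1)) * e1 - (s * (b - a).2) * e2
      have h2 : s * r * dot (b - a) (c - a) < 0 := mul_neg_of_pos_of_neg (mul_pos hsp hrp) h
      nlinarith [sq_nonneg (s * (b - a).1), sq_nonneg (s * (b - a).2)]
  rcases hsr with rfl | rfl
  · simp
  · rw [hr]; simp

/-- For two segments with a common end, meeting only there is stable under perturbation. -/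
theorem eventually_segment_inter_subset {ι : Type*} {l : Filter ι} {a b c : ι → ℝ × ℝ}
    {a₀ b₀ c₀ : ℝ × ℝ} (ha : Tendsto a l (𝓝 a₀)) (hb : Tendsto b l (𝓝 b₀))
    (hc : Tendsto c l (𝓝 c₀)) (hab : a₀ ≠ b₀) (hac : a₀ ≠ c₀)
    (h : segment ℝ a₀ b₀ ∩ segment ℝ a₀ c₀ ⊆ {a₀}) :
    ∀ᶠ t in l, segment ℝ (a t) (b t) ∩ segment ℝ (a t) (c t) ⊆ {a t} := by
  have hp : Tendsto (fun t => (b t - a t, c t - a t)) l (𝓝 (b₀ - a₀, c₀ - a₀)) :=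
    (hb.sub ha).prodMk_nhds (hc.sub ha)
  have h1 := (continuous_cross.tendsto _).comp hp
  have h2 := (continuous_dot.tendsto _).comp hp
  rcases cross_ne_zero_or_dot_neg hab hac h with h | h
  · filter_upwards [h1.eventually_ne h] with t ht
    exact segment_inter_subset_of_cross_or_dot (Or.inl ht)
  · filter_upwards [h2.eventually_lt_const h] with t ht
    exact segment_inter_subset_of_cross_or_dot (Or.inr ht)

/-- At a corner of a simple polygonal arc there is a vector to the left of both segments. -/
theorem exists_left_vector {a b c : ℝ × ℝ} (hab : a ≠ b) (hbc : b ≠ c)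
    (h : segment ℝ a b ∩ segment ℝ b c ⊆ {b}) :
    ∃ w, 0 < cross (b - a) w ∧ 0 < cross (c - b) w := by
  rw [segment_symm] at h
  rcases cross_ne_zero_or_dot_neg hab.symm hbc h with h | h
  · set k := cross (a - b) (c - b) with hk
    have hkk : 0 < k * k := mul_self_pos.2 h
    -- The direction of the median at the corner, with the sign taken from the turn; both cross
    -- products equal `k * k`.
    refine ⟨(-k) • (a - b) - k • (c - b), ?_, ?_⟩
    · convert hkk using 1
      simp only [hk, cross, Prod.fst_sub, Prod.snd_sub, Prod.smul_fst, Prod.smul_snd, smul_eq_mul]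
      ring
    · convert hkk using 1
      simp only [hk, cross, Prod.fst_sub, Prod.snd_sub, Prod.smul_fst, Prod.smul_snd, smul_eq_mul]
      ring
  -- The turn is by less than a right angle, so the quarter turn of `b - a` is to the left of both
  -- segments.
  · refine ⟨(-(b - a).2, (b - a).1), ?_, ?_⟩
    · have := dot_self_pos (sub_ne_zero.2 hab.symm)
      simp only [dot, cross] at this ⊢; linarith
    · simp only [dot, cross, Prod.fst_sub, Prod.snd_sub] at h ⊢; linarith

end SteinbergCircular

namespace SteinbergCircular

open Filter Topology

/-! ### Simple polygonal lines -/

/-- The `i`-th segment of the polygonal line with vertices `q`. -/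
def seg (q : ℕ → ℝ × ℝ) (i : ℕ) : Set (ℝ × ℝ) := segment ℝ (q i) (q (i + 1))

/-- The polygonal line with vertices `q 0, …, q n` is simple. -/
structure IsPolyline (n : ℕ) (q : ℕ → ℝ × ℝ) : Prop where
  ne : ∀ i, i < n → q i ≠ q (i + 1)
  meet : ∀ i j, i < j → j < n → ∀ z, z ∈ seg q i → z ∈ seg q j → j = i + 1 ∧ z = q j

theorem left_mem_seg (q : ℕ → ℝ × ℝ) (i : ℕ) : q i ∈ seg q i := left_mem_segment ℝ _ _

theorem right_mem_seg (q : ℕ → ℝ × ℝ) (i : ℕ) : q (i + 1) ∈ seg q i := right_mem_segment ℝ _ _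

theorem isPolygonalArc_iff {A : Set (ℝ × ℝ)} {x y : ℝ × ℝ} :
    IsPolygonalArc A x y ↔ ∃ (n : ℕ) (q : ℕ → ℝ × ℝ), 0 < n ∧ q 0 = x ∧ q n = y ∧
      (∀ z, z ∈ A ↔ ∃ i < n, z ∈ seg q i) ∧ IsPolyline n q := by
  constructor
  · rintro ⟨n, q, hn, h0, h1, hA, hne, hadj, hdis⟩
    refine ⟨n, q, hn, h0, h1, fun z => by simp [hA, seg], hne, ?_⟩
    intro i j hij hj z hzi hzj
    by_cases h : j = i + 1
    · subst h
      have := hadj i hj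
      exact ⟨rfl, this.subset ⟨hzi, hzj⟩⟩
    · exact absurd hzj (Set.disjoint_left.1 (hdis i j (by omega) hj) hzi)
  · rintro ⟨n, q, hn, h0, h1, hA, hq⟩
    refine ⟨n, q, hn, h0, h1, ?_, hq.ne, ?_, ?_⟩
    · ext z; simp [hA, seg]
    · intro i hi
      refine Set.Subset.antisymm ?_ ?_
      · rintro z ⟨h1, h2⟩
        exact (hq.meet i (i + 1) (by omega) hi z h1 h2).2
      · rintro z rfl
        exact ⟨right_mem_seg q i, left_mem_seg q (i + 1)⟩
    · intro i j hij hj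
      rw [Set.disjoint_left]
      intro z h1 h2
      have := (hq.meet i j (by omega) hj z h1 h2).1
      omega

namespace IsPolyline

variable {n : ℕ} {q : ℕ → ℝ × ℝ}

theorem eq_or_eq_of_mem_seg (hq : IsPolyline n q) {k i : ℕ} (hk : k ≤ n) (hi : i < n)
    (h : q k ∈ seg q i) : k = i ∨ k = i + 1 := by
  rcases hk.lt_or_eq with hk | rfl
  · rcases lt_trichotomy i k with hik | rfl | hik
    · exact Or.inr (hq.meet i k hik hk _ h (left_mem_seg q k)).1
    · exact Or.inl rfl
    · obtain ⟨h1, h2⟩ := hq.meet k i hik hi _ (left_mem_seg q k) h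
      exact absurd (h1 ▸ h2) (hq.ne k hk)
  · obtain ⟨m, rfl⟩ : ∃ m, k = m + 1 := ⟨k - 1, by omega⟩
    rcases (Nat.lt_succ_iff.1 hi).lt_or_eq with him | rfl
    · obtain ⟨h1, h2⟩ := hq.meet i m him (by omega) _ h (right_mem_seg q m)
      exact absurd h2.symm (hq.ne m (by omega))
    · exact Or.inr rfl

theorem injOn (hq : IsPolyline n q) {k k' : ℕ} (hk : k ≤ n) (hk' : k' ≤ n) (h : q k = q k') :
    k = k' := by
  by_contra hne
  wlog hlt : k < k' generalizing k k'
  · exact this hk' hk h.symm (Ne.symm hne) (by omega)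
  rcases hq.eq_or_eq_of_mem_seg hk' (i := k) (by omega) (h ▸ left_mem_seg q k) with h' | h'
  · omega
  · exact hq.ne k (by omega) (h' ▸ h)

theorem shift (hq : IsPolyline n q) {s m : ℕ} (h : s + m ≤ n) :
    IsPolyline m fun i => q (s + i) where
  ne i hi := hq.ne (s + i) (by omega)
  meet i j hij hj z hzi hzj := by
    obtain ⟨h1, h2⟩ := hq.meet (s + i) (s + j) (by omega) (by omega) z hzi hzj
    exact ⟨by omega, h2⟩

theorem reverse (hq : IsPolyline n q) : IsPolyline n fun i => q (n - i) where
  ne i hi := by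
    have := hq.ne (n - (i + 1)) (by omega)
    rw [show n - (i + 1) + 1 = n - i by omega] at this
    exact this.symm
  meet i j hij hj z hzi hzj := by
    have key : ∀ k < n, seg (fun i => q (n - i)) k = seg q (n - (k + 1)) := fun k hk => by
      rw [seg, seg, segment_symm, show n - (k + 1) + 1 = n - k by omega]
    rw [key i (by omega)] at hzi
    rw [key j hj] at hzj
    obtain ⟨h1, h2⟩ := hq.meet _ _ (by omega) (by omega) z hzj hzi
    refine ⟨by omega, ?_⟩
    rw [h2]
    congr 1
    omega

end IsPolyline

theorem IsPolygonalArc.symm {A : Set (ℝ × ℝ)} {x y : ℝ × ℝ} (h : IsPolygonalArc A x y) :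
    IsPolygonalArc A y x := by
  rw [isPolygonalArc_iff] at h ⊢
  obtain ⟨n, q, hn, h0, h1, hA, hq⟩ := h
  refine ⟨n, fun i => q (n - i), hn, by simpa, by simpa, ?_, hq.reverse⟩
  intro z
  have key : ∀ k < n, seg (fun i => q (n - i)) k = seg q (n - (k + 1)) := fun k hk => by
    rw [seg, seg, segment_symm, show n - (k + 1) + 1 = n - k by omega]
  rw [hA]
  constructor
  · rintro ⟨i, hi, hz⟩
    refine ⟨n - (i + 1), by omega, ?_⟩
    rw [key _ (by omega), show n - (n - (i + 1) + 1) = i by omega]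
    exact hz
  · rintro ⟨i, hi, hz⟩
    rw [key i hi] at hz
    exact ⟨_, by omega, hz⟩

theorem midpoint_split (a b : ℝ × ℝ) :
    segment ℝ a (midpoint ℝ a b) ∪ segment ℝ (midpoint ℝ a b) b = segment ℝ a b ∧
      segment ℝ a (midpoint ℝ a b) ∩ segment ℝ (midpoint ℝ a b) b ⊆ {midpoint ℝ a b} ∧
      (a ≠ b → a ∉ segment ℝ (midpoint ℝ a b) b ∧ b ∉ segment ℝ a (midpoint ℝ a b)) := by
  have hm : midpoint ℝ a b = (1 / 2 : ℝ) • a + (1 / 2 : ℝ) • b := by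
    rw [midpoint_eq_smul_add, smul_add]; norm_num
  rw [hm]
  refine ⟨?_, ?_, ?_⟩
  · ext z
    simp only [Set.mem_union, mem_segment_iff_param]
    constructor
    · rintro (⟨s, h0, h1, rfl⟩ | ⟨s, h0, h1, rfl⟩)
      · exact ⟨s / 2, by linarith, by linarith, by module⟩
      · exact ⟨(1 + s) / 2, by linarith, by linarith, by module⟩
    · rintro ⟨s, h0, h1, rfl⟩
      rcases le_total s (1 / 2) with h | h
      · exact Or.inl ⟨2 * s, by linarith, by linarith, by module⟩
      · exact Or.inr ⟨2 * s - 1, by linarith, by linarith, by module⟩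
  · by_cases hab : a = b
    · subst hab
      rw [show (1 / 2 : ℝ) • a + (1 / 2 : ℝ) • a = a by module]
      simp
    rintro z ⟨h1, h2⟩
    obtain ⟨s, hs0, hs1, rfl⟩ := mem_segment_iff_param.1 h1
    obtain ⟨r, hr0, hr1, hr⟩ := mem_segment_iff_param.1 h2
    have e : ((1 + r) / 2 - s / 2) • (b - a) = 0 := by
      rw [← sub_eq_zero] at hr
      rw [← neg_eq_zero, ← hr]
      module
    rcases smul_eq_zero.1 e with e | e
    · have : s = 1 := by linarith
      subst this
      simp
    · exact absurd (sub_eq_zero.1 e).symm hab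
  · intro hab
    have hba : b - a ≠ 0 := sub_ne_zero.2 hab.symm
    simp only [mem_segment_iff_param]
    constructor
    · rintro ⟨s, h0, h1, h⟩
      have e : ((1 + s) / 2) • (b - a) = 0 := by
        rw [← sub_eq_zero] at h
        rw [← neg_eq_zero, ← h]
        module
      rcases smul_eq_zero.1 e with e | e
      · linarith
      · exact hba e
    · rintro ⟨s, h0, h1, h⟩
      have e : (1 - s / 2) • (b - a) = 0 := by
        rw [← sub_eq_zero] at h
        rw [← h]
        module
      rcases smul_eq_zero.1 e with e | e
      · linarith
      · exact hba e

/-- Insert the midpoint of the first segment as a new vertex. -/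
noncomputable def splitFirst (q : ℕ → ℝ × ℝ) : ℕ → ℝ × ℝ
  | 0 => q 0
  | 1 => midpoint ℝ (q 0) (q 1)
  | k + 2 => q (k + 1)

/-- Adds a vertex without changing the point set. Repeating this makes room on an arc for all
subdivision vertices. -/
theorem IsPolyline.splitFirst {n : ℕ} {q : ℕ → ℝ × ℝ} (hn : 0 < n) (hq : IsPolyline n q) :
    IsPolyline (n + 1) (splitFirst q) ∧
      ∀ z, (∃ i < n + 1, z ∈ seg (SteinbergCircular.splitFirst q) i) ↔ ∃ i < n, z ∈ seg q i := by
  obtain ⟨hu, hi, he⟩ := midpoint_split (q 0) (q 1)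
  have h01 := hq.ne 0 hn
  obtain ⟨he1, he2⟩ := he h01
  have s0 : seg (SteinbergCircular.splitFirst q) 0 = segment ℝ (q 0) (midpoint ℝ (q 0) (q 1)) := rfl
  have s1 : seg (SteinbergCircular.splitFirst q) 1 = segment ℝ (midpoint ℝ (q 0) (q 1)) (q 1) := rfl
  have s2 : ∀ k, seg (SteinbergCircular.splitFirst q) (k + 2) = seg q (k + 1) := fun k => rfl
  have hu' : seg q 0 = _ := hu.symm
  refine ⟨⟨?_, ?_⟩, ?_⟩
  · rintro (_ | _ | k) hk
    · intro h
      exact he1 (Set.mem_of_eq_of_mem h (left_mem_segment ℝ _ _))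
    · intro h
      exact he2 (Set.mem_of_eq_of_mem h.symm (right_mem_segment ℝ _ _))
    · exact hq.ne (k + 1) (by omega)
  · rintro (_ | _ | i) (_ | _ | j) hij hj z hzi hzj
    all_goals first | omega | skip
    · exact ⟨rfl, hi ⟨hzi, hzj⟩⟩
    · rw [s0] at hzi
      rw [s2] at hzj
      obtain ⟨h1, h2⟩ := hq.meet 0 (j + 1) (by omega) (by omega) z
        (hu'.symm.subset (Or.inl hzi)) hzj
      rw [h1] at h2
      exact absurd (h2 ▸ hzi) he2
    · rw [s1] at hzi
      rw [s2] at hzj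
      obtain ⟨h1, h2⟩ := hq.meet 0 (j + 1) (by omega) (by omega) z
        (hu'.symm.subset (Or.inr hzi)) hzj
      exact ⟨by omega, h2⟩
    · rw [s2] at hzi hzj
      obtain ⟨h1, h2⟩ := hq.meet (i + 1) (j + 1) (by omega) (by omega) z hzi hzj
      exact ⟨by omega, h2⟩
  · intro z
    constructor
    · rintro ⟨_ | _ | i, hi, hz⟩
      · exact ⟨0, hn, hu'.symm.subset (Or.inl hz)⟩
      · exact ⟨0, hn, hu'.symm.subset (Or.inr hz)⟩
      · exact ⟨i + 1, by omega, hz⟩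
    · rintro ⟨_ | i, hi, hz⟩
      · rcases hu'.subset hz with h | h
        · exact ⟨0, by omega, h⟩
        · exact ⟨1, by omega, h⟩
      · exact ⟨i + 2, by omega, hz⟩

/-- A simple polygonal arc can be written with arbitrarily many segments. -/
theorem IsPolygonalArc.exists_polyline {A : Set (ℝ × ℝ)} {x y : ℝ × ℝ} (h : IsPolygonalArc A x y)
    (M : ℕ) : ∃ (n : ℕ) (q : ℕ → ℝ × ℝ), 0 < n ∧ M ≤ n ∧ q 0 = x ∧ q n = y ∧
      (∀ z, z ∈ A ↔ ∃ i < n, z ∈ seg q i) ∧ IsPolyline n q := by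
  induction M with
  | zero =>
    obtain ⟨n, q, hn, h0, h1, hA, hq⟩ := isPolygonalArc_iff.1 h
    exact ⟨n, q, hn, by omega, h0, h1, hA, hq⟩
  | succ M ih =>
    obtain ⟨n, q, hn, hM, h0, h1, hA, hq⟩ := ih
    obtain ⟨h2, h3⟩ := hq.splitFirst hn
    refine ⟨n + 1, splitFirst q, by omega, by omega, h0, ?_, fun z => by rw [h3, hA], h2⟩
    obtain ⟨m, rfl⟩ : ∃ m, n = m + 1 := ⟨n - 1, by omega⟩
    exact h1

end SteinbergCircular

namespace SteinbergCircular

open Filter Topology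

/-! ### Perturbing polygonal lines -/

theorem eventually_forall_lt {ι : Type*} {l : Filter ι} {n : ℕ} {p : ℕ → ι → Prop}
    (h : ∀ i < n, ∀ᶠ t in l, p i t) : ∀ᶠ t in l, ∀ i < n, p i t :=
  (Filter.eventually_all_finite (Set.finite_Iio n)).2 h

/-- Being a simple polygonal line is stable under perturbation of the vertices. -/
theorem IsPolyline.eventually {ι : Type*} {l : Filter ι} {n : ℕ} {q : ℕ → ℝ × ℝ}
    (hq : IsPolyline n q) {r : ι → ℕ → ℝ × ℝ} (hr : ∀ k, Tendsto (fun t => r t k) l (𝓝 (q k))) :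
    ∀ᶠ t in l, IsPolyline n (r t) := by
  have h1 : ∀ᶠ t in l, ∀ i < n, r t i ≠ r t (i + 1) := eventually_forall_lt fun i hi =>
    (((hr i).sub (hr (i + 1))).eventually_ne (sub_ne_zero.2 (hq.ne i hi))).mono
      fun _ h => sub_ne_zero.1 h
  have h2 : ∀ᶠ t in l, ∀ j < n, ∀ i < j, ∀ z, z ∈ seg (r t) i → z ∈ seg (r t) j →
      j = i + 1 ∧ z = r t j := by
    refine eventually_forall_lt fun j hj => eventually_forall_lt fun i hi => ?_
    by_cases hji : j = i + 1
    · subst hji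
      have := eventually_segment_inter_subset (hr (i + 1)) (hr i) (hr (i + 2))
        (hq.ne i (by omega)).symm (hq.ne (i + 1) hj) (by
          rintro z ⟨hz1, hz2⟩
          rw [segment_symm] at hz1
          exact (hq.meet i (i + 1) hi hj z hz1 hz2).2)
      filter_upwards [this] with t ht z hz1 hz2
      rw [seg, segment_symm] at hz1
      exact ⟨rfl, ht ⟨hz1, hz2⟩⟩
    · have := eventually_disjoint_segment (hr i) (hr (i + 1)) (hr j) (hr (j + 1)) (by
          rw [Set.disjoint_left]
          intro z hz1 hz2
          exact hji (hq.meet i j hi hj z hz1 hz2).1)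
      filter_upwards [this] with t ht z hz1 hz2
      exact absurd hz2 (Set.disjoint_left.1 ht hz1)
  filter_upwards [h1, h2] with t ht1 ht2
  exact ⟨ht1, fun i j hij hj z => ht2 j hj i hij z⟩

/-- A segment of a polygonal line that contains an end of the line has that end as an end, also
after a perturbation that fixes the ends of the line. -/
theorem IsPolyline.exists_segment_eq {ι : Type*} {n : ℕ} {q : ℕ → ℝ × ℝ} (hq : IsPolyline n q)
    {r : ι → ℕ → ℝ × ℝ} (h0 : ∀ t, r t 0 = q 0) (hn : ∀ t, r t n = q n) {z : ℝ × ℝ}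
    (hz : z = q 0 ∨ z = q n) {i : ℕ} (hi : i < n) (hzi : z ∈ seg q i) :
    ∃ k, z ≠ q k ∧ seg q i = segment ℝ z (q k) ∧ ∀ t, seg (r t) i = segment ℝ z (r t k) := by
  rcases hz with rfl | rfl
  · rcases hq.eq_or_eq_of_mem_seg (Nat.zero_le n) hi hzi with h | h
    · subst h
      exact ⟨1, hq.ne 0 hi, rfl, fun t => by rw [← h0 t]; rfl⟩
    · omega
  · rcases hq.eq_or_eq_of_mem_seg le_rfl hi hzi with h | h
    · omega
    · subst h
      exact ⟨i, (hq.ne i hi).symm, segment_symm ℝ _ _, fun t => by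
        rw [← hn t]; exact segment_symm ℝ _ _⟩

/-- If two polygonal lines meet only in common ends, and have at most one such end, then the same
holds after small perturbations that fix the ends. -/
theorem IsPolyline.eventually_meet {ι : Type*} {l : Filter ι} {n n' : ℕ} {q q' : ℕ → ℝ × ℝ}
    (hq : IsPolyline n q) (hq' : IsPolyline n' q') {r r' : ι → ℕ → ℝ × ℝ}
    (hr : ∀ k, Tendsto (fun t => r t k) l (𝓝 (q k)))
    (hr' : ∀ k, Tendsto (fun t => r' t k) l (𝓝 (q' k)))
    (h0 : ∀ t, r t 0 = q 0) (hn : ∀ t, r t n = q n)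
    (h0' : ∀ t, r' t 0 = q' 0) (hn' : ∀ t, r' t n' = q' n') {C : Set (ℝ × ℝ)}
    (hCq : ∀ z ∈ C, z = q 0 ∨ z = q n) (hCq' : ∀ z ∈ C, z = q' 0 ∨ z = q' n')
    (hC : C.Subsingleton)
    (h : ∀ i < n, ∀ j < n', seg q i ∩ seg q' j ⊆ C) :
    ∀ᶠ t in l, ∀ i < n, ∀ j < n', seg (r t) i ∩ seg (r' t) j ⊆ C := by
  refine eventually_forall_lt fun i hi => eventually_forall_lt fun j hj => ?_
  by_cases hd : Disjoint (seg q i) (seg q' j)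
  · filter_upwards [eventually_disjoint_segment (hr i) (hr (i + 1)) (hr' j) (hr' (j + 1)) hd]
      with t ht
    rintro z ⟨hz1, hz2⟩
    exact absurd hz2 (Set.disjoint_left.1 ht hz1)
  -- Touching segments share a point of `C`, which is an end of both lines and stays fixed. Both
  -- segments therefore start at `z`, and stability for segments with a common end applies.
  · obtain ⟨z, hz1, hz2⟩ := Set.not_disjoint_iff.1 hd
    have hzC := h i hi j hj ⟨hz1, hz2⟩
    obtain ⟨k, hk1, hk2, hk3⟩ := hq.exists_segment_eq h0 hn (hCq z hzC) hi hz1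
    obtain ⟨k', hk1', hk2', hk3'⟩ := hq'.exists_segment_eq h0' hn' (hCq' z hzC) hj hz2
    have := eventually_segment_inter_subset (tendsto_const_nhds (x := z)) (hr k) (hr' k') hk1 hk1'
      (by
        rw [← hk2, ← hk2']
        exact fun y hy => hC (h i hi j hj hy) hzC)
    filter_upwards [this] with t ht
    rw [hk3, hk3']
    intro y hy
    rw [ht hy]
    exact hzC

/-! ### A parallel copy of a polygonal line -/

/-- Displacements of the inner vertices to the left side of a polygonal line. -/
structure IsLeftShift (n : ℕ) (q w : ℕ → ℝ × ℝ) : Prop where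
  zero : w 0 = 0
  last : w n = 0
  left_next : ∀ m, 0 < m → m < n → 0 < cross (q (m + 1) - q m) (w m)
  left_prev : ∀ m, m + 1 < n → 0 < cross (q (m + 1) - q m) (w (m + 1))

theorem IsPolyline.exists_isLeftShift {n : ℕ} {q : ℕ → ℝ × ℝ} (hq : IsPolyline n q) :
    ∃ w, IsLeftShift n q w := by
  have : ∀ m, ∃ w : ℝ × ℝ, (m + 1 < n → 0 < cross (q (m + 1) - q m) w ∧
      0 < cross (q (m + 2) - q (m + 1)) w) := fun m => by
    by_cases h : m + 1 < n
    · obtain ⟨w, hw⟩ := exists_left_vector (hq.ne m (by omega)) (hq.ne (m + 1) h)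
        (fun z hz => (hq.meet m (m + 1) (by omega) h z hz.1 hz.2).2)
      exact ⟨w, fun _ => hw⟩
    · exact ⟨0, fun h' => absurd h' h⟩
  choose w hw using this
  -- The chosen `w m` belongs to the corner `q (m + 1)`, hence the index `k - 1`.
  refine ⟨fun k => if k = 0 ∨ k = n then 0 else w (k - 1), by simp, by simp, ?_, ?_⟩
  · intro m hm hmn
    obtain ⟨m, rfl⟩ : ∃ k, m = k + 1 := ⟨m - 1, by omega⟩
    simpa [hmn.ne] using (hw m hmn).2
  · intro m hmn
    simpa [hmn.ne] using (hw m hmn).1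

theorem cross_convex (d x a b : ℝ × ℝ) (s : ℝ) :
    cross d ((1 - s) • a + s • b - x) = (1 - s) * cross d (a - x) + s * cross d (b - x) := by
  simp only [cross, Prod.fst_sub, Prod.snd_sub, Prod.fst_add, Prod.snd_add, Prod.smul_fst,
    Prod.smul_snd, smul_eq_mul]
  ring

theorem cross_self (d : ℝ × ℝ) : cross d d = 0 := by simp only [cross]; ring

theorem cross_add (d a b : ℝ × ℝ) : cross d (a + b) = cross d a + cross d b := by
  simp only [cross, Prod.fst_add, Prod.snd_add]; ring

theorem cross_smul (d a : ℝ × ℝ) (t : ℝ) : cross d (t • a) = t * cross d a := by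
  simp only [cross, Prod.smul_fst, Prod.smul_snd, smul_eq_mul]; ring

theorem cross_zero (d : ℝ × ℝ) : cross d 0 = 0 := by simp [cross]

theorem cross_neg_swap (d e : ℝ × ℝ) : cross d (-e) = cross e d := by
  simp only [cross, Prod.fst_neg, Prod.snd_neg]; ring

namespace IsLeftShift

variable {n : ℕ} {q w : ℕ → ℝ × ℝ}

/-- The shifted segment is on the left of the original one, up to the ends of the line. -/
theorem cross_nonneg (hw : IsLeftShift n q w) (hn : 2 ≤ n) {t : ℝ} (ht : 0 < t) {i : ℕ}
    (hi : i < n) {z : ℝ × ℝ} (hz : z ∈ seg (fun k => q k + t • w k) i) :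
    0 ≤ cross (q (i + 1) - q i) (z - q i) ∧
      (cross (q (i + 1) - q i) (z - q i) = 0 → z = q 0 ∨ z = q n) := by
  obtain ⟨s, hs0, hs1, rfl⟩ := mem_segment_iff_param.1 hz
  have e1 : q i + t • w i - q i = t • w i := by abel
  have e2 : q (i + 1) + t • w (i + 1) - q i = (q (i + 1) - q i) + t • w (i + 1) := by abel
  rw [cross_convex, e1, e2, cross_add, cross_self, cross_smul, cross_smul, zero_add]
  have h1 : 0 < i → 0 < t * cross (q (i + 1) - q i) (w i) := fun h =>
    mul_pos ht (hw.left_next i h hi)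
  have h2 : i + 1 < n → 0 < t * cross (q (i + 1) - q i) (w (i + 1)) := fun h =>
    mul_pos ht (hw.left_prev i h)
  -- Since `2 ≤ n`, no segment is both first and last, so at least one end of the segment moves
  -- strictly to the left.
  rcases Nat.eq_zero_or_pos i with rfl | hi0
  · have h2 := h2 (by omega)
    rw [hw.zero, cross_zero]
    refine ⟨by nlinarith, fun h => Or.inl ?_⟩
    have : s = 0 := by
      have h3 : s * (t * cross (q (0 + 1) - q 0) (w (0 + 1))) = 0 := by linarith
      exact (mul_eq_zero.1 h3).resolve_right h2.ne'
    simp [this, hw.zero]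
  · have h1 := h1 hi0
    rcases (Nat.succ_le_of_lt hi).lt_or_eq with hin | hin
    · have h2 := h2 hin
      have : 0 < (1 - s) * (t * cross (q (i + 1) - q i) (w i)) +
          s * (t * cross (q (i + 1) - q i) (w (i + 1))) := by
        rcases hs0.lt_or_eq with h | h
        · exact add_pos_of_nonneg_of_pos (mul_nonneg (by linarith) h1.le) (mul_pos h h2)
        · rw [← h]; simpa using h1
      exact ⟨this.le, fun h => absurd h this.ne'⟩
    · replace hin : i + 1 = n := hin
      rw [hin, hw.last, cross_zero]
      rw [hin] at h1
      refine ⟨by nlinarith, fun h => Or.inr ?_⟩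
      have : 1 - s = 0 := by
        have h3 : (1 - s) * (t * cross (q n - q i) (w i)) = 0 := by linarith
        exact (mul_eq_zero.1 h3).resolve_right h1.ne'
      have : s = 1 := by linarith
      simp [this, hw.last]

theorem meet_same (hw : IsLeftShift n q w) (hn : 2 ≤ n) {t : ℝ} (ht : 0 < t) {i : ℕ}
    (hi : i < n) {z : ℝ × ℝ} (hz : z ∈ seg (fun k => q k + t • w k) i) (hz' : z ∈ seg q i) :
    z = q 0 ∨ z = q n := by
  refine (hw.cross_nonneg hn ht hi hz).2 ?_
  obtain ⟨s, hs0, hs1, rfl⟩ := mem_segment_iff_param.1 hz'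
  rw [cross_convex, sub_self, cross_zero, cross_self]
  ring

theorem cross_pos_of_mem_segment {d x a b z : ℝ × ℝ} (ha : 0 < cross d (a - x))
    (hb : 0 < cross d (b - x)) (hz : z ∈ segment ℝ a b) : 0 < cross d (z - x) := by
  obtain ⟨s, hs0, hs1, rfl⟩ := mem_segment_iff_param.1 hz
  rw [cross_convex]
  rcases hs0.lt_or_eq with h | h
  · exact add_pos_of_nonneg_of_pos (mul_nonneg (by linarith) ha.le) (mul_pos h hb)
  · rw [← h]; simpa using ha

theorem eventually_cross_pos {d x a v : ℝ × ℝ} (h : 0 < cross d (a - x)) :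
    ∀ᶠ t : ℝ in 𝓝[>] 0, 0 < cross d (a + t • v - x) := by
  have hc : Continuous fun t : ℝ => cross d (a + t • v - x) := by
    unfold cross; fun_prop
  have : Tendsto (fun t : ℝ => cross d (a + t • v - x)) (𝓝[>] 0) (𝓝 (cross d (a - x))) := by
    simpa using (hc.tendsto 0).mono_left nhdsWithin_le_nhds
  exact this.eventually_const_lt h

/-- At a left turn, the shifted segment `i` lies strictly to the left of the line through segment `i
+ 1` for small `t`. Otherwise segment `i + 1` is weakly to the right of the line through segment
`i`, while the shifted segment is weakly to its left and touches it only at ends of the polyline. -/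
theorem eventually_meet_next (hw : IsLeftShift n q w) (hn : 2 ≤ n) {i : ℕ} (hi : i + 1 < n) :
    ∀ᶠ t : ℝ in 𝓝[>] 0, ∀ z, z ∈ seg (fun k => q k + t • w k) i → z ∈ seg q (i + 1) →
      z = q 0 ∨ z = q n := by
  by_cases hc : 0 < cross (q (i + 1) - q i) (q (i + 2) - q (i + 1))
  · have h1 : 0 < cross (q (i + 2) - q (i + 1)) (q i - q (i + 1)) := by
      rw [← neg_sub (q (i + 1)) (q i), cross_neg_swap]; exact hc
    filter_upwards [eventually_cross_pos (v := w i) h1, self_mem_nhdsWithin] with t ht ht0 z hz hz'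
    have h2 : 0 < cross (q (i + 2) - q (i + 1)) (q (i + 1) + t • w (i + 1) - q (i + 1)) := by
      rw [add_sub_cancel_left, cross_smul]
      exact mul_pos ht0 (hw.left_next (i + 1) (by omega) hi)
    have h3 := cross_pos_of_mem_segment ht h2 hz
    obtain ⟨s, hs0, hs1, rfl⟩ := mem_segment_iff_param.1 hz'
    rw [cross_convex, sub_self, cross_zero, cross_self] at h3
    linarith
  · filter_upwards [self_mem_nhdsWithin] with t ht0 z hz hz'
    obtain ⟨h1, h2⟩ := hw.cross_nonneg hn ht0 (by omega) hz
    refine h2 (le_antisymm ?_ h1)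
    obtain ⟨s, hs0, hs1, rfl⟩ := mem_segment_iff_param.1 hz'
    have e : q (i + 1 + 1) - q i = (q (i + 1) - q i) + (q (i + 2) - q (i + 1)) := by abel
    rw [cross_convex, cross_self, e, cross_add, cross_self]
    nlinarith

/-- The mirror image of `eventually_meet_next`, with the same split by the direction of the turn. -/
theorem eventually_meet_prev (hw : IsLeftShift n q w) (hn : 2 ≤ n) {i : ℕ} (hi : i + 1 < n) :
    ∀ᶠ t : ℝ in 𝓝[>] 0, ∀ z, z ∈ seg (fun k => q k + t • w k) (i + 1) → z ∈ seg q i →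
      z = q 0 ∨ z = q n := by
  by_cases hc : 0 < cross (q (i + 1) - q i) (q (i + 2) - q (i + 1))
  · filter_upwards [eventually_cross_pos (v := w (i + 2)) hc, self_mem_nhdsWithin]
      with t ht ht0 z hz hz'
    have h2 : 0 < cross (q (i + 1) - q i) (q (i + 1) + t • w (i + 1) - q (i + 1)) := by
      rw [add_sub_cancel_left, cross_smul]
      exact mul_pos ht0 (hw.left_prev i hi)
    have h3 := cross_pos_of_mem_segment h2 ht hz
    obtain ⟨s, hs0, hs1, rfl⟩ := mem_segment_iff_param.1 hz'
    rw [cross_convex, sub_self, cross_zero, ← neg_sub (q (i + 1)) (q i), cross_neg_swap,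
      cross_self] at h3
    linarith
  · filter_upwards [self_mem_nhdsWithin] with t ht0 z hz hz'
    obtain ⟨h1, h2⟩ := hw.cross_nonneg hn ht0 hi hz
    refine h2 (le_antisymm ?_ h1)
    obtain ⟨s, hs0, hs1, rfl⟩ := mem_segment_iff_param.1 hz'
    rw [cross_convex, sub_self, cross_zero, ← neg_sub (q (i + 1)) (q i), cross_neg_swap]
    have hc' : cross (q (i + 1) - q i) (q (i + 1 + 1) - q (i + 1)) ≤ 0 := not_lt.1 hc
    nlinarith

end IsLeftShift

theorem tendsto_add_smul (a v : ℝ × ℝ) :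
    Tendsto (fun t : ℝ => a + t • v) (𝓝[>] 0) (𝓝 a) := by
  have hc : Continuous fun t : ℝ => a + t • v := by fun_prop
  simpa using (hc.tendsto 0).mono_left nhdsWithin_le_nhds

/-- A small left shift of a simple polygonal line meets the line only in its ends. -/
theorem IsPolyline.eventually_meet_leftShift {n : ℕ} {q w : ℕ → ℝ × ℝ} (hq : IsPolyline n q)
    (hn : 2 ≤ n) (hw : IsLeftShift n q w) :
    ∀ᶠ t : ℝ in 𝓝[>] 0, ∀ i < n, ∀ j < n, ∀ z, z ∈ seg (fun k => q k + t • w k) i →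
      z ∈ seg q j → z = q 0 ∨ z = q n := by
  refine eventually_forall_lt fun i hi => eventually_forall_lt fun j hj => ?_
  by_cases h1 : i = j
  · subst h1
    filter_upwards [self_mem_nhdsWithin] with t ht z hz hz'
    exact hw.meet_same hn ht hi hz hz'
  by_cases h2 : j = i + 1
  · subst h2; exact hw.eventually_meet_next hn hj
  by_cases h3 : i = j + 1
  · subst h3; exact hw.eventually_meet_prev hn hi
  have hd : Disjoint (seg q i) (seg q j) := by
    rw [Set.disjoint_left]
    intro z hz hz'
    rcases Nat.lt_or_gt_of_ne h1 with h | h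
    · exact h2 (hq.meet i j h hj z hz hz').1
    · exact h3 (hq.meet j i h hi z hz' hz).1
  filter_upwards [eventually_disjoint_segment (tendsto_add_smul (q i) (w i))
    (tendsto_add_smul (q (i + 1)) (w (i + 1))) tendsto_const_nhds tendsto_const_nhds hd]
    with t ht z hz hz'
  exact absurd hz' (Set.disjoint_left.1 ht hz)

end SteinbergCircular

namespace SteinbergCircular

open Filter Topology

/-! ### Doubling the edges of a plane drawing -/

/-- A plane drawing of the multigraph on `V` with edges `i : I` joining `src i` to `tgt i`; the
edge `i` is the simple polygonal line with vertices `r i 0, …, r i (N i)`. -/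
structure IsMultiDrawing {V I : Type*} (src tgt : I → V) (pt : V → ℝ × ℝ) (N : I → ℕ)
    (r : I → ℕ → ℝ × ℝ) : Prop where
  pt_injective : Function.Injective pt
  zero : ∀ i, r i 0 = pt (src i)
  last : ∀ i, r i (N i) = pt (tgt i)
  isPolyline : ∀ i, IsPolyline (N i) (r i)
  meet : ∀ i i', i ≠ i' → ∀ j < N i, ∀ j' < N i', ∀ z, z ∈ seg (r i) j → z ∈ seg (r i') j' →
    ∃ v, pt v = z ∧ (v = src i ∨ v = tgt i) ∧ (v = src i' ∨ v = tgt i')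
  mem_ends : ∀ i, ∀ j < N i, ∀ v, pt v ∈ seg (r i) j → v = src i ∨ v = tgt i

/-- Every edge of a plane drawing of a finite graph can be doubled. -/
theorem PlaneDrawing.exists_doubled {V : Type*} [Finite V] {G : SimpleGraph V}
    (D : PlaneDrawing G) {src tgt : G.edgeSet → V} (hst : ∀ e, s(src e, tgt e) = e.1) (M : ℕ) :
    ∃ (N : G.edgeSet → ℕ) (r : G.edgeSet × Bool → ℕ → ℝ × ℝ), (∀ e, M ≤ N e) ∧
      IsMultiDrawing (fun i : G.edgeSet × Bool => src i.1) (fun i => tgt i.1) D.pt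
        (fun i => N i.1) r := by
  have hadj : ∀ e, G.Adj (src e) (tgt e) := fun e => by
    have := e.2
    rwa [← hst e, SimpleGraph.mem_edgeSet] at this
  have hmem : ∀ e v, v ∈ e.1 ↔ v = src e ∨ v = tgt e := fun e v => by
    rw [← hst e, Sym2.mem_iff]
  have harc : ∀ e, IsPolygonalArc (D.arc e.1) (D.pt (src e)) (D.pt (tgt e)) := fun e => by
    have := D.isPolygonalArc _ _ (hadj e)
    rwa [hst e] at this
  -- At least two segments are needed: an arc with no inner vertex would not move under the shift.
  choose N q hN0 hNM h0 h1 hA hq using fun e => (harc e).exists_polyline (max M 2)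
  choose w hw using fun e => (hq e).exists_isLeftShift
  have hN2 : ∀ e, 2 ≤ N e := fun e => (le_max_right _ _).trans (hNM e)
  -- The copy `false` is the original line; the copy `true` is shifted by `t`.
  let R : ℝ → G.edgeSet × Bool → ℕ → ℝ × ℝ := fun t i k =>
    q i.1 k + (if i.2 then t else 0) • w i.1 k
  have hRt : ∀ t e k, R t (e, true) k = q e k + t • w e k := fun t e k => by simp [R]
  have hRf : ∀ t e, R t (e, false) = q e := fun t e => by funext k; simp [R]
  have hR0 : ∀ t i, R t i 0 = q i.1 0 := fun t i => by simp [R, (hw i.1).zero]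
  have hR1 : ∀ t i, R t i (N i.1) = q i.1 (N i.1) := fun t i => by simp [R, (hw i.1).last]
  have hRlim : ∀ i k, Tendsto (fun t => R t i k) (𝓝[>] 0) (𝓝 (q i.1 k)) := by
    rintro ⟨e, _ | _⟩ k
    · simp only [hRf]; exact tendsto_const_nhds
    · simp only [hRt]; exact tendsto_add_smul _ _
  have E1 : ∀ᶠ t in 𝓝[>] (0 : ℝ), ∀ i, IsPolyline (N i.1) (R t i) :=
    eventually_all.2 fun i => (hq i.1).eventually (hRlim i)
  have E2 : ∀ᶠ t in 𝓝[>] (0 : ℝ), ∀ e, ∀ i < N e, ∀ j < N e, ∀ z, z ∈ seg (R t (e, true)) i →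
      z ∈ seg (R t (e, false)) j → z = q e 0 ∨ z = q e (N e) := by
    refine eventually_all.2 fun e => ?_
    filter_upwards [(hq e).eventually_meet_leftShift (hN2 e) (hw e)] with t ht
    have : R t (e, true) = fun k => q e k + t • w e k := funext fun k => hRt t e k
    rw [hRf, this]
    exact ht
  have E3 : ∀ᶠ t in 𝓝[>] (0 : ℝ), ∀ i i' : G.edgeSet × Bool, i.1 ≠ i'.1 → ∀ j < N i.1,
      ∀ j' < N i'.1, seg (R t i) j ∩ seg (R t i') j' ⊆ {z | ∃ v, D.pt v = z ∧
        (v = src i.1 ∨ v = tgt i.1) ∧ (v = src i'.1 ∨ v = tgt i'.1)} := by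
    refine eventually_all.2 fun i => eventually_all.2 fun i' => ?_
    by_cases hne : i.1 = i'.1
    · exact Eventually.of_forall fun t h => absurd hne h
    refine ((hq i.1).eventually_meet (hq i'.1) (hRlim i) (hRlim i') (hR0 · i) (hR1 · i)
      (hR0 · i') (hR1 · i') ?_ ?_ ?_ ?_).mono fun t ht _ => ht
    · rintro z ⟨v, rfl, rfl | rfl, -⟩
      · exact Or.inl (h0 _).symm
      · exact Or.inr (h1 _).symm
    · rintro z ⟨v, rfl, -, rfl | rfl⟩
      · exact Or.inl (h0 _).symm
      · exact Or.inr (h1 _).symm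
    -- As `G` is simple, two different edges share at most one vertex.
    · rintro z ⟨v, rfl, hv, hv'⟩ z' ⟨v', rfl, hu, hu'⟩
      by_contra hvv
      have hvv' : v ≠ v' := fun h => hvv (by rw [h])
      apply hne
      rw [← hmem] at hv hv' hu hu'
      apply Subtype.ext
      rw [(Sym2.mem_and_mem_iff hvv').1 ⟨hv, hu⟩, (Sym2.mem_and_mem_iff hvv').1 ⟨hv', hu'⟩]
    · rintro j hj j' hj' z ⟨hz, hz'⟩
      obtain ⟨v, hv, hv', rfl⟩ := D.inter_subset _ i.1.2 _ i'.1.2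
        (fun h => hne (Subtype.ext h)) z ⟨(hA _ z).2 ⟨j, hj, hz⟩, (hA _ z).2 ⟨j', hj', hz'⟩⟩
      exact ⟨v, rfl, (hmem _ _).1 hv, (hmem _ _).1 hv'⟩
  have E4 : ∀ᶠ t in 𝓝[>] (0 : ℝ), ∀ i : G.edgeSet × Bool, ∀ v, ∀ j < N i.1,
      D.pt v ∈ seg (R t i) j → v = src i.1 ∨ v = tgt i.1 := by
    refine eventually_all.2 fun i => eventually_all.2 fun v => eventually_forall_lt fun j hj => ?_
    by_cases hv : v ∈ i.1.1
    · exact Eventually.of_forall fun t _ => (hmem _ _).1 hv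
    -- The vertex is treated as a degenerate segment, so that stability of disjointness applies.
    have hd : Disjoint (segment ℝ (q i.1 j) (q i.1 (j + 1))) (segment ℝ (D.pt v) (D.pt v)) := by
      rw [segment_same, Set.disjoint_singleton_right]
      intro h
      exact hv (D.mem_of_pt_mem _ i.1.2 v ((hA _ _).2 ⟨j, hj, h⟩))
    filter_upwards [eventually_disjoint_segment (hRlim i j) (hRlim i (j + 1)) tendsto_const_nhds
      tendsto_const_nhds hd] with t ht h
    rw [segment_same, Set.disjoint_singleton_right] at ht
    exact absurd h ht
  obtain ⟨t, ⟨T1, T2⟩, T3, T4⟩ := ((E1.and E2).and (E3.and E4)).exists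
  have hends : ∀ e z, z = q e 0 ∨ z = q e (N e) → ∃ v, D.pt v = z ∧ (v = src e ∨ v = tgt e) := by
    rintro e z (rfl | rfl)
    · exact ⟨_, (h0 e).symm, Or.inl rfl⟩
    · exact ⟨_, (h1 e).symm, Or.inr rfl⟩
  refine ⟨N, R t, fun e => (le_max_left _ _).trans (hNM e), D.pt_injective,
    fun i => (hR0 t i).trans (h0 _), fun i => (hR1 t i).trans (h1 _), T1, ?_,
    fun i j hj v => T4 i v j hj⟩
  rintro ⟨e, b⟩ ⟨e', b'⟩ hne j hj j' hj' z hz hz'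
  by_cases he : e = e'
  · subst he
    have : z = q e 0 ∨ z = q e (N e) := by
      cases b <;> cases b'
      · exact absurd rfl hne
      · exact T2 e _ hj' _ hj z hz' hz
      · exact T2 e _ hj _ hj' z hz hz'
      · exact absurd rfl hne
    obtain ⟨v, hv1, hv2⟩ := hends e z this
    exact ⟨v, hv1, hv2, hv2⟩
  · exact T3 (e, b) (e', b') he j hj j' hj' ⟨hz, hz'⟩

end SteinbergCircular

namespace SteinbergCircular

/-! ### Subdivisions of multigraphs -/

section Subdivision

variable {V I : Type*} (src tgt : I → V) (ℓ : I → ℕ)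

/-- The vertices of the subdivision in which the edge `i` becomes a path of length `ℓ i`. -/
abbrev SubdivVert (V : Type*) {I : Type*} (ℓ : I → ℕ) : Type _ :=
  V ⊕ {x : I × ℕ // 0 < x.2 ∧ x.2 < ℓ x.1}

instance [Finite V] [Finite I] : Finite (SubdivVert V ℓ) := by
  have : Finite {x : I × ℕ // 0 < x.2 ∧ x.2 < ℓ x.1} :=
    Finite.of_injective (β := Σ i, Fin (ℓ i)) (fun x => ⟨x.1.1, ⟨x.1.2, x.2.2⟩⟩) (by
      rintro ⟨⟨i, j⟩, h⟩ ⟨⟨i', j'⟩, h'⟩ he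
      obtain ⟨h1, h2⟩ := Sigma.mk.inj_iff.1 he
      simp only at h1
      subst h1
      have := congrArg Fin.val (eq_of_heq h2)
      simp only at this
      subst this
      rfl)
  infer_instance

/-- The `j`-th vertex of the path that replaces the edge `i`. -/
def node (i : I) (j : ℕ) : SubdivVert V ℓ :=
  if h : 0 < j ∧ j < ℓ i then Sum.inr ⟨(i, j), h⟩
  else if j = 0 then Sum.inl (src i) else Sum.inl (tgt i)

/-- The `j`-th edge of the path that replaces the edge `i`. -/
def nodeEdge (i : I) (j : ℕ) : Sym2 (SubdivVert V ℓ) :=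
  s(node src tgt ℓ i j, node src tgt ℓ i (j + 1))

/-- The graph obtained from a multigraph by replacing each edge `i` by a path of length `ℓ i`. -/
def subdivision : SimpleGraph (SubdivVert V ℓ) :=
  SimpleGraph.fromEdgeSet {e | ∃ i j, j < ℓ i ∧ e = nodeEdge src tgt ℓ i j}

variable {src tgt ℓ}

theorem node_zero (i : I) : node src tgt ℓ i 0 = Sum.inl (src i) := by simp [node]

theorem node_last {i : I} (h : ℓ i ≠ 0) : node src tgt ℓ i (ℓ i) = Sum.inl (tgt i) := by
  simp [node, h]

theorem node_of_lt {i : I} {j : ℕ} (h : 0 < j ∧ j < ℓ i) :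
    node src tgt ℓ i j = Sum.inr ⟨(i, j), h⟩ := by simp [node, h]

theorem node_eq_node_of_lt {i i' : I} {j j' : ℕ} (h : 0 < j ∧ j < ℓ i)
    (he : node src tgt ℓ i j = node src tgt ℓ i' j') : i = i' ∧ j = j' := by
  rw [node_of_lt h, node] at he
  split_ifs at he
  simpa using he

theorem node_injOn {i : I} (hst : src i ≠ tgt i) {j j' : ℕ} (hj : j ≤ ℓ i) (hj' : j' ≤ ℓ i)
    (he : node src tgt ℓ i j = node src tgt ℓ i j') : j = j' := by
  by_cases h : 0 < j ∧ j < ℓ i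
  · exact (node_eq_node_of_lt h he).2
  by_cases h' : 0 < j' ∧ j' < ℓ i
  · exact (node_eq_node_of_lt h' he.symm).2.symm
  simp only [node, h, h', dite_false] at he
  split_ifs at he with h1 h2 h2
  · omega
  · simp [hst] at he
  · simp [hst.symm] at he
  · omega

/-- As `2 ≤ ℓ i`, every edge of a path has an inner vertex of that path, and this vertex determines
`i`. -/
theorem nodeEdge_inj (hℓ : ∀ i, 2 ≤ ℓ i) (hst : ∀ i, src i ≠ tgt i) {i i' : I} {j j' : ℕ}
    (hj : j < ℓ i) (hj' : j' < ℓ i')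
    (he : nodeEdge src tgt ℓ i j = nodeEdge src tgt ℓ i' j') : i = i' ∧ j = j' := by
  have hi : i = i' := by
    rw [nodeEdge, nodeEdge, Sym2.eq_iff] at he
    have := hℓ i
    rcases Nat.eq_zero_or_pos j with h0 | h0
    · have h1 : 0 < j + 1 ∧ j + 1 < ℓ i := by omega
      rcases he with ⟨-, he⟩ | ⟨-, he⟩ <;> exact (node_eq_node_of_lt h1 he).1
    · rcases he with ⟨he, -⟩ | ⟨he, -⟩ <;> exact (node_eq_node_of_lt ⟨h0, hj⟩ he).1
  subst hi
  refine ⟨rfl, ?_⟩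
  rw [nodeEdge, nodeEdge, Sym2.eq_iff] at he
  rcases he with ⟨he, -⟩ | ⟨he, he'⟩
  · exact node_injOn (hst i) hj.le hj'.le he
  · have h1 := node_injOn (hst i) hj.le (by omega) he
    have h2 := node_injOn (hst i) (by omega) (by omega) he'
    omega

theorem subdivision_adj (hst : ∀ i, src i ≠ tgt i) {x y : SubdivVert V ℓ} :
    (subdivision src tgt ℓ).Adj x y ↔ ∃ i j, j < ℓ i ∧ s(x, y) = nodeEdge src tgt ℓ i j := by
  rw [subdivision, SimpleGraph.fromEdgeSet_adj]
  refine ⟨fun h => h.1, fun h => ⟨h, ?_⟩⟩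
  rintro rfl
  obtain ⟨i, j, hj, h⟩ := h
  rw [nodeEdge, Sym2.eq_iff] at h
  have : node src tgt ℓ i j = node src tgt ℓ i (j + 1) := by
    rcases h with ⟨h1, h2⟩ | ⟨h1, h2⟩ <;> rw [← h1, ← h2]
  have := node_injOn (hst i) hj.le hj this
  omega

theorem node_adj (hst : ∀ i, src i ≠ tgt i) {i : I} {j : ℕ} (hj : j < ℓ i) :
    (subdivision src tgt ℓ).Adj (node src tgt ℓ i j) (node src tgt ℓ i (j + 1)) :=
  (subdivision_adj hst).2 ⟨i, j, hj, rfl⟩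

end Subdivision

/-! ### Drawing a subdivision -/

section Drawing

variable {V I : Type*} {src tgt : I → V} {ℓ : I → ℕ} {pt : V → ℝ × ℝ} {N : I → ℕ}
  {r : I → ℕ → ℝ × ℝ}

/-- The position on the polygonal line of the `j`-th vertex of the path that replaces `i`. -/
def pos (ℓ N : I → ℕ) (i : I) (j : ℕ) : ℕ := if j < ℓ i then j else N i

/-- The inner path vertices occupy the first vertices of the line, one each, and the last path edge
takes all remaining segments. The inequality `ℓ i ≤ N i` leaves it at least one. -/
theorem pos_lt_pos (hN : ∀ i, ℓ i ≤ N i) {i : I} {j j' : ℕ} (h : j < j') (hj' : j' ≤ ℓ i) :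
    pos ℓ N i j < pos ℓ N i j' := by
  have := hN i
  simp only [pos]
  split_ifs <;> omega

theorem pos_le (hN : ∀ i, ℓ i ≤ N i) (i : I) (j : ℕ) : pos ℓ N i j ≤ N i := by
  have := hN i
  simp only [pos]
  split_ifs <;> omega

theorem le_of_pos_le_pos (hN : ∀ i, ℓ i ≤ N i) {i : I} {j j' : ℕ} (hj : j ≤ ℓ i)
    (h : pos ℓ N i j ≤ pos ℓ N i j') : j ≤ j' := by
  by_contra! hlt
  exact absurd (pos_lt_pos hN hlt hj) (by omega)

/-- The point that represents a vertex of the subdivision. -/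
def subdivPt (ℓ : I → ℕ) (pt : V → ℝ × ℝ) (r : I → ℕ → ℝ × ℝ) : SubdivVert V ℓ → ℝ × ℝ
  | Sum.inl v => pt v
  | Sum.inr x => r x.1.1 x.1.2

/-- The part of the polygonal line `r i` between its `j`-th and next subdivision vertex. -/
def subArc (ℓ N : I → ℕ) (r : I → ℕ → ℝ × ℝ) (i : I) (j : ℕ) : Set (ℝ × ℝ) :=
  {z | ∃ k, pos ℓ N i j ≤ k ∧ k < pos ℓ N i (j + 1) ∧ z ∈ seg (r i) k}

namespace IsMultiDrawing

theorem subdivPt_node (hD : IsMultiDrawing src tgt pt N r) (hℓ : ∀ i, 2 ≤ ℓ i) {i : I} {j : ℕ}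
    (hj : j ≤ ℓ i) : subdivPt ℓ pt r (node src tgt ℓ i j) = r i (pos ℓ N i j) := by
  have := hℓ i
  rcases Nat.eq_zero_or_pos j with rfl | h0
  · rw [node_zero, pos, if_pos (by omega), hD.zero]; rfl
  rcases hj.lt_or_eq with h | rfl
  · rw [node_of_lt ⟨h0, h⟩, pos, if_pos h]; rfl
  · rw [node_last (by omega), pos, if_neg (by omega), hD.last]; rfl

theorem not_exists_pt_eq (hD : IsMultiDrawing src tgt pt N r) {i : I} {j : ℕ} (h0 : 0 < j)
    (hj : j < N i) {v : V} (hv : v = src i ∨ v = tgt i) : pt v ≠ r i j := by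
  intro h
  rcases hv with rfl | rfl
  · rw [← hD.zero] at h
    have := (hD.isPolyline i).injOn (Nat.zero_le _) hj.le h
    omega
  · rw [← hD.last] at h
    have := (hD.isPolyline i).injOn le_rfl hj.le h
    omega

/-- An inner vertex of another path cannot lie here: different lines meet only in points of `V`, and
inner vertices of a line differ from its ends. -/
theorem exists_node_eq (hD : IsMultiDrawing src tgt pt N r) (hℓ : ∀ i, 2 ≤ ℓ i)
    (hN : ∀ i, ℓ i ≤ N i) {i : I} {k : ℕ} (hk : k < N i) {x : SubdivVert V ℓ}
    (h : subdivPt ℓ pt r x ∈ seg (r i) k) : ∃ j ≤ ℓ i, x = node src tgt ℓ i j := by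
  have := hℓ i
  rcases x with v | ⟨⟨i', j'⟩, h0, hj'⟩
  · rcases hD.mem_ends i k hk v h with rfl | rfl
    · exact ⟨0, by omega, (node_zero i).symm⟩
    · exact ⟨ℓ i, le_rfl, (node_last (by omega)).symm⟩
  · simp only at h0 hj'
    by_cases hi : i' = i
    · subst hi
      exact ⟨j', hj'.le, (node_of_lt ⟨h0, hj'⟩).symm⟩
    · have hlt : j' < N i' := hj'.trans_le (hN i')
      obtain ⟨v, hv, hv', -⟩ := hD.meet i' i hi j' hlt k hk _ (left_mem_seg _ _) h
      exact absurd hv (hD.not_exists_pt_eq h0 hlt hv')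

theorem subdivPt_injective (hD : IsMultiDrawing src tgt pt N r) (hℓ : ∀ i, 2 ≤ ℓ i)
    (hN : ∀ i, ℓ i ≤ N i) : Function.Injective (subdivPt ℓ pt r) := by
  have key : ∀ (x : SubdivVert V ℓ) (y : {x : I × ℕ // 0 < x.2 ∧ x.2 < ℓ x.1}),
      subdivPt ℓ pt r x = subdivPt ℓ pt r (Sum.inr y) → x = Sum.inr y := by
    rintro x ⟨⟨i, j⟩, h0, hj⟩ h
    simp only at h0 hj
    have hlt : j < N i := hj.trans_le (hN i)
    obtain ⟨j', hj', rfl⟩ := hD.exists_node_eq hℓ hN hlt (x := x) (h ▸ left_mem_seg (r i) j)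
    rw [hD.subdivPt_node hℓ hj'] at h
    have h1 := (hD.isPolyline i).injOn (pos_le hN i j') hlt.le h
    have h2 : pos ℓ N i j = j := by rw [pos, if_pos hj]
    have h3 : j' = j := le_antisymm (le_of_pos_le_pos hN hj' (by omega))
      (le_of_pos_le_pos hN hj.le (by omega))
    rw [h3, node_of_lt ⟨h0, hj⟩]
  intro x y h
  rcases y with v | y
  · rcases x with u | x
    · exact congrArg Sum.inl (hD.pt_injective h)
    · exact (key _ _ h.symm).symm
  · exact key _ _ h

theorem eq_or_eq_of_mem_subArc (hD : IsMultiDrawing src tgt pt N r) (hℓ : ∀ i, 2 ≤ ℓ i)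
    (hN : ∀ i, ℓ i ≤ N i) {i : I} {j : ℕ} (hj : j < ℓ i) {x : SubdivVert V ℓ}
    (h : subdivPt ℓ pt r x ∈ subArc ℓ N r i j) : x ∈ nodeEdge src tgt ℓ i j := by
  obtain ⟨k, hk1, hk2, hk⟩ := h
  have hkN : k < N i := hk2.trans_le (pos_le hN i _)
  obtain ⟨j', hj', rfl⟩ := hD.exists_node_eq hℓ hN hkN hk
  rw [hD.subdivPt_node hℓ hj'] at hk
  have h1 := (hD.isPolyline i).eq_or_eq_of_mem_seg (pos_le hN i j') hkN hk
  have h2 : j ≤ j' := le_of_pos_le_pos hN hj.le (by omega)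
  have h3 : j' ≤ j + 1 := le_of_pos_le_pos hN hj' (by omega)
  rw [nodeEdge, Sym2.mem_iff]
  rcases (by omega : j' = j ∨ j' = j + 1) with rfl | rfl
  · exact Or.inl rfl
  · exact Or.inr rfl

theorem isPolygonalArc_subArc (hD : IsMultiDrawing src tgt pt N r) (hℓ : ∀ i, 2 ≤ ℓ i)
    (hN : ∀ i, ℓ i ≤ N i) {i : I} {j : ℕ} (hj : j < ℓ i) :
    IsPolygonalArc (subArc ℓ N r i j) (subdivPt ℓ pt r (node src tgt ℓ i j))
      (subdivPt ℓ pt r (node src tgt ℓ i (j + 1))) := by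
  rw [isPolygonalArc_iff, hD.subdivPt_node hℓ hj.le,
    hD.subdivPt_node hℓ (j := j + 1) hj]
  have hlt : pos ℓ N i j < pos ℓ N i (j + 1) := pos_lt_pos hN (Nat.lt_succ_self j) hj
  refine ⟨pos ℓ N i (j + 1) - pos ℓ N i j, fun k => r i (pos ℓ N i j + k), by omega, rfl, ?_, ?_,
    (hD.isPolyline i).shift ?_⟩
  · simp only
    congr 1
    omega
  · intro z
    constructor
    · rintro ⟨k, hk1, hk2, hk⟩
      refine ⟨k - pos ℓ N i j, by omega, ?_⟩
      have e : pos ℓ N i j + (k - pos ℓ N i j) = k := by omega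
      simp only [seg, ← add_assoc, e]
      exact hk
    · rintro ⟨k, hk, hz⟩
      exact ⟨pos ℓ N i j + k, by omega, by omega, hz⟩
  · have := pos_le hN i (j + 1)
    omega

theorem subArc_inter (hD : IsMultiDrawing src tgt pt N r) (hℓ : ∀ i, 2 ≤ ℓ i)
    (hN : ∀ i, ℓ i ≤ N i) {i i' : I} {j j' : ℕ} (hj : j < ℓ i) (hj' : j' < ℓ i')
    (hne : ¬(i = i' ∧ j = j')) {z : ℝ × ℝ} (hz : z ∈ subArc ℓ N r i j)
    (hz' : z ∈ subArc ℓ N r i' j') :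
    ∃ x, x ∈ nodeEdge src tgt ℓ i j ∧ x ∈ nodeEdge src tgt ℓ i' j' ∧ subdivPt ℓ pt r x = z := by
  obtain ⟨k, hk1, hk2, hk⟩ := id hz
  obtain ⟨k', hk1', hk2', hk'⟩ := id hz'
  have hkN : k < N i := hk2.trans_le (pos_le hN i _)
  have hkN' : k' < N i' := hk2'.trans_le (pos_le hN i' _)
  -- Once `z` is known to be a vertex, `eq_or_eq_of_mem_subArc` makes it an end of both edges.
  suffices ∃ x, subdivPt ℓ pt r x = z by
    obtain ⟨x, rfl⟩ := this
    exact ⟨x, hD.eq_or_eq_of_mem_subArc hℓ hN hj hz, hD.eq_or_eq_of_mem_subArc hℓ hN hj' hz', rfl⟩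
  by_cases hi : i = i'
  · subst hi
    replace hne : j ≠ j' := fun h => hne ⟨rfl, h⟩
    have key : ∀ {j j' k k' : ℕ}, j' < ℓ i → j < j' → k < pos ℓ N i (j + 1) →
        pos ℓ N i j' ≤ k' → k' < N i → z ∈ seg (r i) k → z ∈ seg (r i) k' →
        ∃ x, subdivPt ℓ pt r x = z := by
      intro j j' k k' hj' hlt hk hk' hkN hz hz'
      have h1 : pos ℓ N i (j + 1) ≤ pos ℓ N i j' := by
        rcases (Nat.succ_le_of_lt hlt).lt_or_eq with h | h
        · exact (pos_lt_pos hN h hj'.le).le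
        · exact (congrArg _ h).le
      obtain ⟨h2, h3⟩ := (hD.isPolyline i).meet k k' (by omega) hkN z hz hz'
      refine ⟨node src tgt ℓ i j', ?_⟩
      rw [hD.subdivPt_node hℓ hj'.le, h3]
      congr 1
      omega
    rcases Nat.lt_or_gt_of_ne hne with h | h
    · exact key hj' h hk2 hk1' hkN' hk hk'
    · exact key hj h hk2' hk1 hkN hk' hk
  · obtain ⟨v, hv, -⟩ := hD.meet i i' hi k hkN k' hkN' z hk hk'
    exact ⟨Sum.inl v, hv⟩

/-- Subdivisions of plane multigraphs are planar. -/
theorem isPlanar_subdivision (hD : IsMultiDrawing src tgt pt N r) (hℓ : ∀ i, 2 ≤ ℓ i)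
    (hN : ∀ i, ℓ i ≤ N i) (hst : ∀ i, src i ≠ tgt i) : IsPlanar (subdivision src tgt ℓ) := by
  let arc : Sym2 (SubdivVert V ℓ) → Set (ℝ × ℝ) := fun e =>
    {z | ∃ i j, j < ℓ i ∧ e = nodeEdge src tgt ℓ i j ∧ z ∈ subArc ℓ N r i j}
  have harc : ∀ i j, j < ℓ i → arc (nodeEdge src tgt ℓ i j) = subArc ℓ N r i j := by
    intro i j hj
    ext z
    constructor
    · rintro ⟨i', j', hj', he, hz⟩
      obtain ⟨rfl, rfl⟩ := nodeEdge_inj hℓ hst hj hj' he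
      exact hz
    · exact fun hz => ⟨i, j, hj, rfl, hz⟩
  have hedge : ∀ e ∈ (subdivision src tgt ℓ).edgeSet,
      ∃ i j, j < ℓ i ∧ e = nodeEdge src tgt ℓ i j := by
    intro e he
    induction e with
    | _ x y => exact (subdivision_adj hst).1 he
  refine ⟨⟨subdivPt ℓ pt r, arc, hD.subdivPt_injective hℓ hN, ?_, ?_, ?_⟩⟩
  · intro x y hxy
    obtain ⟨i, j, hj, he⟩ := (subdivision_adj hst).1 hxy
    rw [he, harc i j hj]
    rw [nodeEdge, Sym2.eq_iff] at he
    rcases he with ⟨rfl, rfl⟩ | ⟨rfl, rfl⟩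
    · exact hD.isPolygonalArc_subArc hℓ hN hj
    · exact (hD.isPolygonalArc_subArc hℓ hN hj).symm
  · intro e he x hx
    obtain ⟨i, j, hj, rfl⟩ := hedge e he
    rw [harc i j hj] at hx
    exact hD.eq_or_eq_of_mem_subArc hℓ hN hj hx
  · intro e he e' he' hne z hz
    obtain ⟨i, j, hj, rfl⟩ := hedge e he
    obtain ⟨i', j', hj', rfl⟩ := hedge e' he'
    rw [harc i j hj, harc i' j' hj'] at hz
    refine hD.subArc_inter hℓ hN hj hj' ?_ hz.1 hz.2
    rintro ⟨rfl, rfl⟩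
    exact hne rfl

end IsMultiDrawing

end Drawing

end SteinbergCircular

namespace SteinbergCircular

open SimpleGraph

/-! ### Cycles in graphs -/

section Cycles

variable {W : Type*} {H : SimpleGraph W}

/-- A cycle is 2-regular, so each of its edges at `x` has exactly one partner there. -/
theorem _root_.SimpleGraph.Walk.IsCycle.exists_pair_of_mem_edges {v x y : W} {c : H.Walk v v}
    (hc : c.IsCycle) (h : s(x, y) ∈ c.edges) :
    ∃ y' ≠ y, ∀ z, s(x, z) ∈ c.edges ↔ z = y ∨ z = y' := by
  have h2 := hc.ncard_neighborSet_toSubgraph_eq_two (c.fst_mem_support_of_mem_edges h)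
  have hmem : ∀ z, z ∈ c.toSubgraph.neighborSet x ↔ s(x, z) ∈ c.edges := fun z => by
    rw [Subgraph.mem_neighborSet, Walk.adj_toSubgraph_iff_mem_edges]
  obtain ⟨a, b, hab, hs⟩ := Set.ncard_eq_two.1 h2
  simp only [hs, Set.mem_insert_iff, Set.mem_singleton_iff] at hmem
  rcases (hmem y).2 h with rfl | rfl
  · exact ⟨b, hab.symm, fun z => (hmem z).symm⟩
  · exact ⟨a, hab, fun z => by rw [← hmem z, or_comm]⟩

theorem _root_.SimpleGraph.Walk.IsCycle.eq_or_eq_of_mem_edges {v x y y' z : W} {c : H.Walk v v}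
    (hc : c.IsCycle) (hy : s(x, y) ∈ c.edges) (hy' : s(x, y') ∈ c.edges) (hne : y' ≠ y)
    (hz : s(x, z) ∈ c.edges) : z = y ∨ z = y' := by
  obtain ⟨b, -, hb⟩ := hc.exists_pair_of_mem_edges hy
  have h1 := ((hb y').1 hy').resolve_left hne
  rw [h1]
  exact (hb z).1 hz

theorem _root_.SimpleGraph.Walk.mem_iff_of_mem_support {u v : W} (w : H.Walk u v) {X : Set W}
    (hX : ∀ x y, s(x, y) ∈ w.edges → x ∈ X → y ∈ X) {y : W} (hy : y ∈ w.support) :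
    u ∈ X ↔ y ∈ X := by
  induction w with
  | nil => simp only [Walk.support_nil, List.mem_singleton] at hy; rw [hy]
  | @cons a b d h p ih =>
    rw [Walk.support_cons, List.mem_cons] at hy
    rcases hy with rfl | hy
    · rfl
    · rw [← ih (fun x y hxy => hX x y (by simp [hxy])) hy]
      exact ⟨hX a b (by simp), hX b a (by simp [Sym2.eq_swap])⟩

/-- A finite graph with an edge in which no vertex has degree one contains a cycle. -/
theorem not_isAcyclic_of_forall_exists_ne [Finite W] {a b : W} (hab : H.Adj a b)
    (h : ∀ u v, H.Adj u v → ∃ v' ≠ v, H.Adj u v') : ¬ H.IsAcyclic := by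
  intro hH
  -- In an acyclic graph a path can be left at its end by an edge other than the last one and
  -- remains a path, so paths would be arbitrarily long.
  have key : ∀ n : ℕ, ∃ (u v : W) (p : H.Walk u v), p.IsPath ∧ p.length = n + 1 := by
    intro n
    induction n with
    | zero => exact ⟨a, b, hab.toWalk, by simp [hab.ne], rfl⟩
    | succ n ih =>
      obtain ⟨u, v, p, hp, hl⟩ := ih
      have hnil : ¬ p.Nil := fun hn => by have := Walk.length_eq_zero_iff.2 hn; omega
      obtain ⟨w, hw, hvw⟩ := h v p.penultimate (p.adj_penultimate hnil).symm
      refine ⟨u, w, p.concat hvw, hp.concat (fun hs => ?_) hvw, by simp [hl]⟩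
      exact hw (hH.eq_penultimate_of_adj_end hp hvw hs)
  cases nonempty_fintype W
  obtain ⟨u, v, p, hp, hl⟩ := key (Fintype.card W)
  have := hp.length_lt
  omega

end Cycles

/-! ### Cycles in subdivisions -/

section SubdivisionCycles

variable {V I : Type*} {src tgt : I → V} {ℓ : I → ℕ}

theorem eq_or_eq_of_mem_nodeEdge {i i' : I} {j m : ℕ} (hm : 0 < m ∧ m < ℓ i)
    {y : SubdivVert V ℓ} (h : s(node src tgt ℓ i m, y) = nodeEdge src tgt ℓ i' j) :
    i = i' ∧ (m = j ∧ y = node src tgt ℓ i (m + 1) ∨ m = j + 1 ∧ y = node src tgt ℓ i j) := by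
  rw [nodeEdge, Sym2.eq_iff] at h
  rcases h with ⟨h, rfl⟩ | ⟨h, rfl⟩ <;> obtain ⟨rfl, rfl⟩ := node_eq_node_of_lt hm h <;> simp

theorem eq_or_eq_of_inl_mem_nodeEdge {i : I} {j : ℕ} (hj : j < ℓ i) {v : V} {y : SubdivVert V ℓ}
    (h : s(Sum.inl v, y) = nodeEdge src tgt ℓ i j) :
    j = 0 ∧ v = src i ∧ y = node src tgt ℓ i 1 ∨
      j + 1 = ℓ i ∧ v = tgt i ∧ y = node src tgt ℓ i j := by
  rw [nodeEdge, Sym2.eq_iff] at h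
  rcases h with ⟨h, rfl⟩ | ⟨h, rfl⟩
  · by_cases h0 : 0 < j
    · rw [node_of_lt ⟨h0, hj⟩] at h; simp at h
    · obtain rfl : j = 0 := by omega
      rw [node_zero] at h
      exact Or.inl ⟨rfl, Sum.inl_injective h, rfl⟩
  · by_cases h0 : j + 1 < ℓ i
    · rw [node_of_lt ⟨by omega, h0⟩] at h; simp at h
    · have h1 : j + 1 = ℓ i := by omega
      rw [h1, node_last (by omega)] at h
      exact Or.inr ⟨h1, Sum.inl_injective h, rfl⟩

variable {x₀ : SubdivVert V ℓ} {c : (subdivision src tgt ℓ).Walk x₀ x₀}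

theorem exists_nodeEdge_eq (hst : ∀ i, src i ≠ tgt i) {e : Sym2 (SubdivVert V ℓ)}
    (he : e ∈ c.edges) : ∃ i j, j < ℓ i ∧ e = nodeEdge src tgt ℓ i j := by
  have := c.edges_subset_edgeSet he
  induction e with
  | _ x y => exact (subdivision_adj hst).1 this

/-- A cycle that uses one edge of a subdivided path uses the whole path. -/
theorem nodeEdge_mem_edges_of_mem (hst : ∀ i, src i ≠ tgt i) (hc : c.IsCycle) {i : I} {j j' : ℕ}
    (hj : j < ℓ i) (hj' : j' < ℓ i) (h : nodeEdge src tgt ℓ i j ∈ c.edges) :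
    nodeEdge src tgt ℓ i j' ∈ c.edges := by
  -- An inner vertex of a path has only the two path edges at it, so a cycle through one uses the
  -- other.
  have step : ∀ m, m + 1 < ℓ i →
      (nodeEdge src tgt ℓ i m ∈ c.edges ↔ nodeEdge src tgt ℓ i (m + 1) ∈ c.edges) := by
    intro m hm
    constructor
    · intro h
      have h' : s(node src tgt ℓ i (m + 1), node src tgt ℓ i m) ∈ c.edges := by
        rwa [Sym2.eq_swap]
      obtain ⟨y, hy, hyz⟩ := hc.exists_pair_of_mem_edges h'
      have hyc := (hyz y).2 (Or.inr rfl)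
      obtain ⟨i', j', -, he⟩ := exists_nodeEdge_eq hst hyc
      obtain ⟨rfl, ⟨rfl, h2⟩ | ⟨h1, h2⟩⟩ := eq_or_eq_of_mem_nodeEdge ⟨by omega, hm⟩ he
      · rwa [he] at hyc
      · obtain rfl : m = j' := by omega
        exact absurd h2 hy
    · intro h
      obtain ⟨y, hy, hyz⟩ := hc.exists_pair_of_mem_edges h
      have hyc := (hyz y).2 (Or.inr rfl)
      obtain ⟨i', j', -, he⟩ := exists_nodeEdge_eq hst hyc
      obtain ⟨rfl, ⟨h1, h2⟩ | ⟨h1, h2⟩⟩ := eq_or_eq_of_mem_nodeEdge ⟨by omega, hm⟩ he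
      · exact absurd h2 hy
      · obtain rfl : m = j' := by omega
        rwa [he] at hyc
  have all : ∀ m, m < ℓ i →
      (nodeEdge src tgt ℓ i 0 ∈ c.edges ↔ nodeEdge src tgt ℓ i m ∈ c.edges) := by
    intro m
    induction m with
    | zero => exact fun _ => Iff.rfl
    | succ m ih => exact fun hm => (ih (by omega)).trans (step m hm)
  exact (all j' hj').1 ((all j hj).2 h)

/-- Lower bounds on cycle lengths come from counting pairs `(i, j)`, since distinct pairs index
distinct edges. -/
theorem card_le_length (hℓ : ∀ i, 2 ≤ ℓ i) (hst : ∀ i, src i ≠ tgt i) (T : Finset (I × ℕ))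
    (hT : ∀ x ∈ T, x.2 < ℓ x.1 ∧ nodeEdge src tgt ℓ x.1 x.2 ∈ c.edges) :
    T.card ≤ c.length := by
  classical
  rw [← Walk.length_edges]
  refine le_trans ?_ (List.toFinset_card_le c.edges)
  refine Finset.card_le_card_of_injOn (fun x => nodeEdge src tgt ℓ x.1 x.2) ?_ ?_
  · intro x hx
    simpa using (hT x hx).2
  · intro x hx y hy h
    obtain ⟨h1, h2⟩ := nodeEdge_inj hℓ hst (hT x hx).1 (hT y hy).1 h
    exact Prod.ext h1 h2

/-- The path of length `ℓ i` that replaces the edge `i`. -/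
theorem exists_isPath_length_eq (hℓ : ∀ i, 2 ≤ ℓ i) (hst : ∀ i, src i ≠ tgt i) (i : I) :
    ∃ p : (subdivision src tgt ℓ).Walk (Sum.inl (src i)) (Sum.inl (tgt i)),
      p.IsPath ∧ p.length = ℓ i := by
  have key : ∀ j ≤ ℓ i, ∃ p : (subdivision src tgt ℓ).Walk (node src tgt ℓ i 0)
      (node src tgt ℓ i j), p.IsPath ∧ p.length = j ∧
        ∀ x ∈ p.support, ∃ k ≤ j, x = node src tgt ℓ i k := by
    intro j
    induction j with
    | zero =>
      intro _
      exact ⟨Walk.nil, by simp, rfl, fun x hx => ⟨0, le_rfl, by simpa using hx⟩⟩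
    | succ j ih =>
      intro hj
      obtain ⟨p, hp, hl, hs⟩ := ih (by omega)
      refine ⟨p.concat (node_adj hst hj), hp.concat (fun hx => ?_) _, by simp [hl], ?_⟩
      · obtain ⟨k, hk, he⟩ := hs _ hx
        have := node_injOn (hst i) hj (by omega) he
        omega
      · intro x hx
        rw [Walk.support_concat, List.mem_append, List.mem_singleton] at hx
        rcases hx with hx | rfl
        · obtain ⟨k, hk, he⟩ := hs _ hx
          exact ⟨k, by omega, he⟩
        · exact ⟨j + 1, le_rfl, rfl⟩
  have := hℓ i
  obtain ⟨p, hp, hl, -⟩ := key (ℓ i) le_rfl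
  refine ⟨p.copy (node_zero i) (node_last (by omega)), by simpa using hp, by simpa using hl⟩

end SubdivisionCycles

end SteinbergCircular

namespace SteinbergCircular

open SimpleGraph

/-! ### Replacing edges by odd cycles -/

section OddCycles

/-- The lengths of the two paths that replace an edge. -/
def pathLength {E : Type*} (a : ℕ) (i : E × Bool) : ℕ := if i.2 then a + 1 else a

theorem two_le_pathLength {E : Type*} {a : ℕ} (ha : 2 ≤ a) (i : E × Bool) :
    2 ≤ pathLength a i := by
  unfold pathLength; split_ifs <;> omega

theorem le_pathLength {E : Type*} (a : ℕ) (i : E × Bool) : a ≤ pathLength a i := by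
  unfold pathLength; split_ifs <;> omega

/-- The graph obtained from the graph with edges `E` by replacing each edge by an odd cycle of
length `2 * a + 1` that contains its ends at distance `a`. -/
abbrev oddReplacement {V E : Type*} (src tgt : E → V) (a : ℕ) :
    SimpleGraph (SubdivVert V (pathLength (E := E) a)) :=
  subdivision (fun i : E × Bool => src i.1) (fun i => tgt i.1) (pathLength a)

variable {V E : Type*} {src tgt : E → V} {a : ℕ} {x₀ : SubdivVert V (pathLength (E := E) a)}
  {c : (oddReplacement src tgt a).Walk x₀ x₀}

local notation "nd" => node (fun i => src (Prod.fst i)) (fun i => tgt (Prod.fst i)) (pathLength a)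

local notation "ndE" => nodeEdge (fun i => src (Prod.fst i)) (fun i => tgt (Prod.fst i)) (pathLength a)

/-- A cycle that uses both paths of an edge has length `2 * a + 1`. -/
theorem length_eq_of_both_mem (ha : 2 ≤ a) (hst : ∀ e, src e ≠ tgt e) (hc : c.IsCycle) (e : E)
    (h : ∀ b, ndE (e, b) 0 ∈ c.edges) : c.length = 2 * a + 1 := by
  classical
  have hst' : ∀ i : E × Bool, src i.1 ≠ tgt i.1 := fun i => hst i.1
  have hℓ : ∀ i : E × Bool, 2 ≤ pathLength a i := two_le_pathLength ha
  have hall : ∀ b j, j < pathLength a (e, b) → ndE (e, b) j ∈ c.edges := fun b j hj =>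
    nodeEdge_mem_edges_of_mem hst' hc (by have := hℓ (e, b); omega) hj (h b)
  have hlt : pathLength a (e, true) = a + 1 := rfl
  have hlf : pathLength a (e, false) = a := rfl
  refine le_antisymm ?_ ?_
  -- The vertices of the two paths. Both cycle edges at each of them stay on these paths, so the
  -- cycle never leaves `X`.
  · let X : Set (SubdivVert V (pathLength (E := E) a)) :=
      {x | ∃ b j, j ≤ pathLength a (e, b) ∧ x = nd (e, b) j}
    have hX : ∀ x y, s(x, y) ∈ c.edges → x ∈ X → y ∈ X := by
      rintro x y hxy ⟨b, j, hj, rfl⟩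
      by_cases hin : 0 < j ∧ j < pathLength a (e, b)
      · obtain ⟨i', j', hj', he⟩ := exists_nodeEdge_eq hst' hxy
        obtain ⟨rfl, ⟨-, h2⟩ | ⟨-, h2⟩⟩ := eq_or_eq_of_mem_nodeEdge hin he
        · exact ⟨b, j + 1, hin.2, h2⟩
        · exact ⟨b, j', hj'.le, h2⟩
      by_cases hj0 : j = 0
      · subst hj0
        have h1 : ∀ b', s(nd (e, b) 0, nd (e, b') 1) ∈ c.edges := fun b' => by
          have := h b'
          rwa [nodeEdge, node_zero, ← node_zero (ℓ := pathLength a)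
            (tgt := fun i : E × Bool => tgt i.1) (src := fun i => src i.1) (e, b)] at this
        have hne : nd (e, true) 1 ≠ nd (e, false) 1 := fun he => by
          have := (node_eq_node_of_lt ⟨by omega, by rw [hlt]; omega⟩ he).1
          simp at this
        rcases hc.eq_or_eq_of_mem_edges (h1 false) (h1 true) hne hxy with rfl | rfl
        · exact ⟨false, 1, by rw [hlf]; omega, rfl⟩
        · exact ⟨true, 1, by rw [hlt]; omega, rfl⟩
      · obtain rfl : j = pathLength a (e, b) := by omega
        have h1 : ∀ b', s(nd (e, b) (pathLength a (e, b)), nd (e, b') (pathLength a (e, b') - 1)) ∈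
            c.edges := fun b' => by
          have h2 := hℓ (e, b')
          have := hall b' (pathLength a (e, b') - 1) (by omega)
          rw [nodeEdge, show pathLength a (e, b') - 1 + 1 = pathLength a (e, b') by omega,
            node_last (by omega), Sym2.eq_swap] at this
          rwa [node_last hj0]
        have hne : nd (e, true) (pathLength a (e, true) - 1) ≠
            nd (e, false) (pathLength a (e, false) - 1) := fun he => by
          have := (node_eq_node_of_lt (by rw [hlt]; omega) he).1
          simp at this
        rcases hc.eq_or_eq_of_mem_edges (h1 false) (h1 true) hne hxy with rfl | rfl
        · exact ⟨false, _, Nat.sub_le _ _, rfl⟩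
        · exact ⟨true, _, Nat.sub_le _ _, rfl⟩
    have hsup : ∀ y ∈ c.support, y ∈ X := by
      have h0 : nd (e, true) 0 ∈ c.support := c.fst_mem_support_of_mem_edges (h true)
      intro y hy
      rw [← c.mem_iff_of_mem_support hX hy, c.mem_iff_of_mem_support hX h0]
      exact ⟨true, 0, Nat.zero_le _, rfl⟩
    -- Lists `X` with each common end once: indices `0, …, a - 1` on the short path and `1, …, a +
    -- 1` on the long one.
    let F : Finset (SubdivVert V (pathLength (E := E) a)) :=
      (Finset.range a).image (nd (e, false)) ∪
        (Finset.range (a + 1)).image fun j => nd (e, true) (j + 1)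
    have hF : c.support.tail.toFinset ⊆ F := by
      intro y hy
      obtain ⟨b, j, hj, rfl⟩ := hsup y (List.mem_of_mem_tail (List.mem_toFinset.1 hy))
      rw [Finset.mem_union, Finset.mem_image, Finset.mem_image]
      cases b
      · rw [hlf] at hj
        rcases hj.lt_or_eq with hj | rfl
        · exact Or.inl ⟨j, Finset.mem_range.2 hj, rfl⟩
        · refine Or.inr ⟨j, by simp, ?_⟩
          have e1 := node_last (src := fun i : E × Bool => src i.1) (tgt := fun i => tgt i.1)
            (ℓ := pathLength j) (i := (e, true)) (by rw [hlt]; omega)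
          have e2 := node_last (src := fun i : E × Bool => src i.1) (tgt := fun i => tgt i.1)
            (ℓ := pathLength j) (i := (e, false)) (by rw [hlf]; omega)
          rw [hlt] at e1
          rw [hlf] at e2
          rw [e1, e2]
      · rw [hlt] at hj
        rcases Nat.eq_zero_or_pos j with rfl | h0
        · exact Or.inl ⟨0, Finset.mem_range.2 (by omega), by rw [node_zero, node_zero]⟩
        · exact Or.inr ⟨j - 1, Finset.mem_range.2 (by omega), by
            rw [show j - 1 + 1 = j by omega]⟩
    calc c.length = c.support.tail.length := by simp
      _ = c.support.tail.toFinset.card := (List.toFinset_card_of_nodup hc.support_nodup).symm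
      _ ≤ F.card := Finset.card_le_card hF
      _ ≤ a + (a + 1) := (Finset.card_union_le _ _).trans (add_le_add
          (Finset.card_image_le.trans (by simp)) (Finset.card_image_le.trans (by simp)))
      _ = 2 * a + 1 := by ring
  · let T : Finset ((E × Bool) × ℕ) :=
      (Finset.range a).image (fun j => ((e, false), j)) ∪
        (Finset.range (a + 1)).image fun j => ((e, true), j)
    have hT : T.card = a + (a + 1) := by
      rw [Finset.card_union_of_disjoint, Finset.card_image_of_injective,
        Finset.card_image_of_injective, Finset.card_range, Finset.card_range]
      · intro j j' h; simpa using h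
      · intro j j' h; simpa using h
      · rw [Finset.disjoint_left]
        intro x hx hx'
        simp only [Finset.mem_image] at hx hx'
        obtain ⟨j, -, rfl⟩ := hx
        obtain ⟨j', -, h⟩ := hx'
        simp at h
    have := card_le_length (c := c) hℓ hst' T (by
      intro x hx
      simp only [T, Finset.mem_union, Finset.mem_image, Finset.mem_range] at hx
      rcases hx with ⟨j, hj, rfl⟩ | ⟨j, hj, rfl⟩
      · exact ⟨hj, hall _ _ hj⟩
      · exact ⟨hj, hall _ _ hj⟩)
    omega

end OddCycles

/-! ### Cycle lengths after the replacement of all edges of a graph of large girth -/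

section EdgeReplacement

variable {V : Type*} {G : SimpleGraph V} {src tgt : G.edgeSet → V} {a : ℕ}
  {x₀ : SubdivVert V (pathLength (E := G.edgeSet) a)}
  {c : (oddReplacement src tgt a).Walk x₀ x₀}

local notation "nd" => node (fun i => src (Prod.fst i)) (fun i => tgt (Prod.fst i)) (pathLength a)

local notation "ndE" => nodeEdge (fun i => src (Prod.fst i)) (fun i => tgt (Prod.fst i)) (pathLength a)

theorem exists_nodeEdge_inl {V I : Type*} {src tgt : I → V} {ℓ : I → ℕ} (hℓ : ∀ i, 2 ≤ ℓ i)
    {i : I} {v : V} (hv : v = src i ∨ v = tgt i) :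
    ∃ j < ℓ i, ∃ y, s(Sum.inl v, y) = nodeEdge src tgt ℓ i j := by
  have := hℓ i
  rcases hv with rfl | rfl
  · exact ⟨0, by omega, _, by rw [nodeEdge, node_zero]⟩
  · refine ⟨ℓ i - 1, by omega, node src tgt ℓ i (ℓ i - 1), ?_⟩
    rw [nodeEdge, show ℓ i - 1 + 1 = ℓ i by omega, node_last (by omega), Sym2.eq_swap]

/-- The cycles of the graph in which each edge is replaced by an odd cycle. -/
theorem length_eq_or_le_length [Finite V] (ha : 2 ≤ a) (hG : ((4 * a : ℕ) : ℕ∞) ≤ G.egirth)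
    (hst : ∀ e, s(src e, tgt e) = e.1) (hc : c.IsCycle) :
    c.length = 2 * a + 1 ∨ 4 * a * a ≤ c.length := by
  classical
  have hadj : ∀ e, G.Adj (src e) (tgt e) := fun e => by
    have := e.2
    rwa [← hst e, SimpleGraph.mem_edgeSet] at this
  have hst' : ∀ i : G.edgeSet × Bool, src i.1 ≠ tgt i.1 := fun i => (hadj i.1).ne
  have hℓ : ∀ i : G.edgeSet × Bool, 2 ≤ pathLength a i := two_le_pathLength ha
  by_cases hboth : ∃ e, ∀ b, ndE (e, b) 0 ∈ c.edges
  · obtain ⟨e, he⟩ := hboth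
    exact Or.inl (length_eq_of_both_mem ha (fun e => (hadj e).ne) hc e he)
  right
  have hone : ∀ e b b', ndE (e, b) 0 ∈ c.edges → ndE (e, b') 0 ∈ c.edges → b = b' := by
    intro e b b' h h'
    by_contra hne
    refine hboth ⟨e, fun b'' => ?_⟩
    have hbool : ∀ b b' b'' : Bool, b ≠ b' → b'' = b ∨ b'' = b' := by decide
    rcases hbool b b' b'' hne with rfl | rfl
    · exact h
    · exact h'
  have hzero : ∀ i j, j < pathLength a i → ndE i j ∈ c.edges → ndE i 0 ∈ c.edges :=
    fun i j hj h => nodeEdge_mem_edges_of_mem hst' hc hj (by have := hℓ i; omega) h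
  -- The edges of `G` whose paths are used by `c`. No vertex has degree one here, so `G'` contains a
  -- cycle `d`, of length at least `4 * a` by the girth of `G`.
  let G' : SimpleGraph V := SimpleGraph.fromEdgeSet
    {x | ∃ h : x ∈ G.edgeSet, ∃ b, ndE (⟨x, h⟩, b) 0 ∈ c.edges}
  have hG'adj : ∀ u v, G'.Adj u v ↔
      ∃ h : s(u, v) ∈ G.edgeSet, ∃ b, ndE (⟨s(u, v), h⟩, b) 0 ∈ c.edges := by
    intro u v
    rw [SimpleGraph.fromEdgeSet_adj]
    exact ⟨fun h => h.1, fun h => ⟨h, G.ne_of_adj h.1⟩⟩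
  have hle : G' ≤ G := fun u v h => ((hG'adj u v).1 h).1
  have hdeg : ∀ u v, G'.Adj u v → ∃ v' ≠ v, G'.Adj u v' := by
    intro u v huv
    obtain ⟨h, b, hb⟩ := (hG'adj u v).1 huv
    have hu : u = src ⟨s(u, v), h⟩ ∨ u = tgt ⟨s(u, v), h⟩ := by
      rw [← Sym2.mem_iff, hst]; exact Sym2.mem_mk_left u v
    obtain ⟨j, hj, y, hy⟩ := exists_nodeEdge_inl (i := (⟨s(u, v), h⟩, b))
      (src := fun i : G.edgeSet × Bool => src i.1) (tgt := fun i => tgt i.1) hℓ hu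
    have hyc : s(Sum.inl u, y) ∈ c.edges := by
      rw [hy]
      exact nodeEdge_mem_edges_of_mem hst' hc (by have := hℓ (⟨s(u, v), h⟩, b); omega) hj hb
    obtain ⟨y', hy', hz⟩ := hc.exists_pair_of_mem_edges hyc
    have hyc' := (hz y').2 (Or.inr rfl)
    obtain ⟨⟨e', b'⟩, j', hj', he'⟩ := exists_nodeEdge_eq hst' hyc'
    have hk : ndE (e', b') 0 ∈ c.edges := hzero _ j' hj' (by rw [← he']; exact hyc')
    have hu' : u = src e' ∨ u = tgt e' := by
      rcases eq_or_eq_of_inl_mem_nodeEdge hj' he' with h | h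
      · exact Or.inl h.2.1
      · exact Or.inr h.2.1
    -- Otherwise both cycle edges at `u` lie on the same path by `hone`; but a path has a single
    -- edge at each of its ends.
    have hne : e' ≠ ⟨s(u, v), h⟩ := by
      rintro rfl
      obtain rfl := hone _ _ _ hb hk
      apply hy'
      have hs := hst' (⟨s(u, v), h⟩, b)
      rcases eq_or_eq_of_inl_mem_nodeEdge hj hy with ⟨h1, h2, h3⟩ | ⟨h1, h2, h3⟩ <;>
        rcases eq_or_eq_of_inl_mem_nodeEdge hj' he' with ⟨h1', h2', h3'⟩ | ⟨h1', h2', h3'⟩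
      · rw [h3, h3']
      · exact absurd (h2.symm.trans h2') hs
      · exact absurd (h2'.symm.trans h2) hs
      · obtain rfl : j = j' := by omega
        rw [h3, h3']
    have humem : u ∈ e'.1 := by rw [← hst e', Sym2.mem_iff]; exact hu'
    obtain ⟨v', hv'⟩ := humem
    refine ⟨v', ?_, ?_⟩
    · rintro rfl
      exact hne (Subtype.ext hv')
    · rw [hG'adj]
      refine ⟨hv' ▸ e'.2, b', ?_⟩
      have : (⟨s(u, v'), hv' ▸ e'.2⟩ : G.edgeSet) = e' := Subtype.ext hv'.symm
      rw [this]
      exact hk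
  obtain ⟨e₀, he₀⟩ : ∃ e₀, e₀ ∈ c.edges := by
    apply List.exists_mem_of_length_pos
    rw [Walk.length_edges]
    have := hc.three_le_length
    omega
  obtain ⟨⟨e, b⟩, j, hj, rfl⟩ := exists_nodeEdge_eq hst' he₀
  have hadj₀ : G'.Adj (src e) (tgt e) := by
    rw [hG'adj]
    refine ⟨hadj e, b, ?_⟩
    have : (⟨s(src e, tgt e), hadj e⟩ : G.edgeSet) = e := Subtype.ext (hst e)
    rw [this]
    exact hzero _ j hj he₀
  have hcyc := not_isAcyclic_of_forall_exists_ne hadj₀ hdeg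
  simp only [SimpleGraph.IsAcyclic, not_forall, not_not] at hcyc
  obtain ⟨u, d, hd⟩ := hcyc
  have hdl : 4 * a ≤ d.length := by
    have h1 := SimpleGraph.egirth_le_length ((Walk.isCycle_mapLe hle).2 hd)
    rw [Walk.length_map] at h1
    exact_mod_cast hG.trans h1
  have hF : ∀ x : {x // x ∈ d.edges.toFinset}, ∃ i : G.edgeSet × Bool, i.1.1 = x.1 ∧
      ndE i 0 ∈ c.edges := by
    rintro ⟨x, hx⟩
    have hx' := d.edges_subset_edgeSet (List.mem_toFinset.1 hx)
    induction x with
    | _ u v =>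
      obtain ⟨h, b, hb⟩ := (hG'adj u v).1 hx'
      exact ⟨(⟨s(u, v), h⟩, b), rfl, hb⟩
  choose F hF1 hF2 using hF
  -- Each edge of `d` contributes the first `a` edges of its path, whichever of the two lengths the
  -- path has.
  let T : Finset ((G.edgeSet × Bool) × ℕ) :=
    (Finset.univ ×ˢ Finset.range a).image fun x => (F x.1, x.2)
  have hT : T.card = d.length * a := by
    rw [Finset.card_image_of_injective, Finset.card_product, Finset.card_univ,
      Fintype.card_coe, List.toFinset_card_of_nodup hd.edges_nodup, Walk.length_edges,
      Finset.card_range]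
    rintro ⟨x, j⟩ ⟨y, j'⟩ h
    obtain ⟨h1, h2⟩ := Prod.mk.inj h
    refine Prod.ext (Subtype.ext ?_) h2
    rw [← hF1 x, ← hF1 y]
    exact congrArg (fun i => i.1.1) h1
  have hTc := card_le_length (c := c) hℓ hst' T (by
    intro x hx
    simp only [T, Finset.mem_image, Finset.mem_product, Finset.mem_range] at hx
    obtain ⟨⟨y, j⟩, ⟨-, hj⟩, rfl⟩ := hx
    have hj' : j < pathLength a (F y) := lt_of_lt_of_le hj (le_pathLength a _)
    have h0 : 0 < pathLength a (F y) := lt_of_lt_of_le two_pos (hℓ (F y))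
    exact ⟨hj', nodeEdge_mem_edges_of_mem hst' hc h0 hj' (hF2 y)⟩)
  rw [hT] at hTc
  exact (Nat.mul_le_mul_right a hdl).trans hTc

end EdgeReplacement

end SteinbergCircular

namespace SteinbergCircular

open SimpleGraph

/-! ### Colorings -/

theorem cycleGraph_adj_zmod {n : ℕ} {x y : ZMod (n + 2)} :
    (cycleGraph (n + 2)).Adj x y ↔ x - y = 1 ∨ y - x = 1 := Iff.rfl

/-- Each step along the path changes the color by 1 or -1; `k` counts the steps of -1. -/
theorem sub_eq_of_hom_cycleGraph {V I : Type*} {src tgt : I → V} {ℓ : I → ℕ}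
    (hst : ∀ i, src i ≠ tgt i) {n : ℕ} (φ : SubdivVert V ℓ → ZMod (n + 2))
    (hφ : ∀ x y, (subdivision src tgt ℓ).Adj x y → φ x - φ y = 1 ∨ φ y - φ x = 1) (i : I)
    {j : ℕ} (hj : j ≤ ℓ i) :
    ∃ k ≤ j, φ (node src tgt ℓ i j) - φ (node src tgt ℓ i 0) = (j : ZMod (n + 2)) - 2 * k := by
  induction j with
  | zero => exact ⟨0, le_rfl, by simp⟩
  | succ j ih =>
    obtain ⟨k, hk, he⟩ := ih (by omega)
    rcases hφ _ _ (node_adj hst hj) with h | h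
    · refine ⟨k + 1, by omega, ?_⟩
      push_cast
      linear_combination he - h
    · refine ⟨k, by omega, ?_⟩
      push_cast
      linear_combination he + h

/-- The number is odd and lies between `-(2 * a + 1)` and `2 * a + 1`, so it equals one of these two
bounds. The lower one forces `k = 0`, the upper one `k = a`. -/
theorem eq_zero_or_eq_of_dvd {a k k' : ℕ} (hk : k ≤ a) (hk' : k' ≤ a + 1)
    (h : ((2 * a + 1 : ℕ) : ℤ) ∣ 1 - 2 * k' + 2 * k) : k = 0 ∨ k = a := by
  obtain ⟨q, hq⟩ := h
  push_cast at hq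
  have h1 : q < 2 := by
    by_contra! hcon
    nlinarith
  have h2 : -2 < q := by
    by_contra! hcon
    nlinarith
  rcases (by omega : q = -1 ∨ q = 0 ∨ q = 1) with rfl | rfl | rfl <;> omega

/-- A coloring by an odd cycle of the graph in which each edge is replaced by an odd cycle gives
such a coloring of the graph. -/
theorem cycleColorable_of_oddReplacement {V : Type*} {G : SimpleGraph V}
    {src tgt : G.edgeSet → V} {a : ℕ} (ha : 2 ≤ a) (hst : ∀ e, s(src e, tgt e) = e.1)
    (h : CycleColorable (oddReplacement src tgt a) (2 * a + 1)) :
    CycleColorable G (2 * a + 1) := by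
  obtain ⟨n, hn⟩ : ∃ n, 2 * a + 1 = n + 2 := ⟨2 * a - 1, by omega⟩
  rw [hn] at h ⊢
  obtain ⟨φ⟩ := h
  have hadj : ∀ e, G.Adj (src e) (tgt e) := fun e => by
    have := e.2
    rwa [← hst e, SimpleGraph.mem_edgeSet] at this
  have hst' : ∀ i : G.edgeSet × Bool, src i.1 ≠ tgt i.1 := fun i => (hadj i.1).ne
  let ψ : SubdivVert V (pathLength (E := G.edgeSet) a) → ZMod (n + 2) := fun x => φ x
  have hψ : ∀ x y, (oddReplacement src tgt a).Adj x y → ψ x - ψ y = 1 ∨ ψ y - ψ x = 1 :=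
    fun x y hxy => cycleGraph_adj_zmod.1 (φ.map_adj hxy)
  have h0 : (2 * a + 1 : ZMod (n + 2)) = 0 := by
    have : ((2 * a + 1 : ℕ) : ZMod (n + 2)) = 0 := by rw [hn]; exact ZMod.natCast_self _
    exact_mod_cast this
  have key : ∀ e, ψ (Sum.inl (tgt e)) - ψ (Sum.inl (src e)) = a ∨
      ψ (Sum.inl (tgt e)) - ψ (Sum.inl (src e)) = -a := by
    intro e
    obtain ⟨k, hk, he⟩ := sub_eq_of_hom_cycleGraph hst' ψ hψ (e, false) le_rfl
    obtain ⟨k', hk', he'⟩ := sub_eq_of_hom_cycleGraph hst' ψ hψ (e, true) le_rfl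
    have hlt : pathLength a (e, true) = a + 1 := rfl
    have hlf : pathLength a (e, false) = a := rfl
    rw [node_zero, node_last (by rw [hlf]; omega), hlf] at he
    rw [node_zero, node_last (by rw [hlt]; omega), hlt] at he'
    rw [hlf] at hk
    rw [hlt] at hk'
    simp only at he he'
    -- The two paths give the same difference, `a - 2 * k` and `a + 1 - 2 * k'` modulo `2 * a + 1`.
    have hd : ((2 * a + 1 : ℕ) : ℤ) ∣ 1 - 2 * k' + 2 * k := by
      rw [hn, ← ZMod.intCast_zmod_eq_zero_iff_dvd _ (n + 2)]
      push_cast at he' ⊢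
      linear_combination he - he'
    rcases eq_zero_or_eq_of_dvd hk hk' hd with rfl | rfl
    · left; rw [he]; simp
    · right; rw [he]; ring
  -- As `-2 * a = 1` modulo `2 * a + 1`, the factor `-2` turns differences `a` and `-a` into 1 and
  -- -1.
  refine ⟨⟨fun v => ((-2 : ZMod (n + 2)) * ψ (Sum.inl v) : ZMod (n + 2)), ?_⟩⟩
  intro u v huv
  have hsym := hst ⟨s(u, v), huv⟩
  have hk := key ⟨s(u, v), huv⟩
  refine cycleGraph_adj_zmod.2 ?_
  rw [Sym2.eq_iff] at hsym
  rcases hsym with ⟨h1, h2⟩ | ⟨h1, h2⟩ <;> rw [h1, h2] at hk <;> rcases hk with hk | hk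
  · right; linear_combination (-2) * hk - h0
  · left; linear_combination 2 * hk - h0
  · left; linear_combination (-2) * hk - h0
  · right; linear_combination 2 * hk - h0

/-- A coloring by the cycle of length `2 * a + 1` gives a circular `(2 * a + 1, a)`-coloring. -/
theorem CycleColorable.hasCircularColoring {V : Type*} {G : SimpleGraph V} {a : ℕ} (ha : 0 < a)
    (h : CycleColorable G (2 * a + 1)) : HasCircularColoring G (2 * a + 1) a := by
  obtain ⟨n, hn⟩ : ∃ n, 2 * a + 1 = n + 2 := ⟨2 * a - 1, by omega⟩
  rw [hn] at h ⊢
  obtain ⟨φ⟩ := h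
  let ψ : V → ZMod (n + 2) := fun v => φ v
  have hψ : ∀ u v, G.Adj u v → ψ u - ψ v = 1 ∨ ψ v - ψ u = 1 :=
    fun u v huv => cycleGraph_adj_zmod.1 (φ.map_adj huv)
  -- Adjacent vertices now differ by `a` or `-a` modulo `2 * a + 1`, so their representatives are at
  -- distance `a` or `a + 1`.
  let θ : V → ZMod (n + 2) := fun v => (a : ZMod (n + 2)) * ψ v
  refine ⟨fun v => (θ v : Fin (n + 2)), fun u v huv => ?_⟩
  have hval : ∀ x : ZMod (n + 2), (((ZMod.val x : ℕ) : ℤ) : ZMod (n + 2)) = x := fun x => by simp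
  have hd : (((n + 2 : ℕ) : ℤ) ∣ (ZMod.val (θ u) : ℤ) - ZMod.val (θ v) - a) ∨
      (((n + 2 : ℕ) : ℤ) ∣ (ZMod.val (θ u) : ℤ) - ZMod.val (θ v) + a) := by
    simp only [← ZMod.intCast_zmod_eq_zero_iff_dvd _ (n + 2)]
    push_cast [hval]
    rcases hψ u v huv with h | h
    · left; simp only [θ]; linear_combination a * h
    · right; simp only [θ]; linear_combination (-a) * h
  have hu : ZMod.val (θ u) < n + 2 := ZMod.val_lt _
  have hv : ZMod.val (θ v) < n + 2 := ZMod.val_lt _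
  change (a : ℤ) ≤ |(ZMod.val (θ u) : ℤ) - ZMod.val (θ v)| ∧
    |(ZMod.val (θ u) : ℤ) - ZMod.val (θ v)| ≤ ((n + 2 : ℕ) : ℤ) - a
  generalize ZMod.val (θ u) = x at *
  generalize ZMod.val (θ v) = y at *
  rw [le_abs, abs_le]
  have hn' : ((n + 2 : ℕ) : ℤ) = 2 * a + 1 := by exact_mod_cast hn.symm
  rw [hn'] at hd ⊢
  rcases hd with ⟨q, hq⟩ | ⟨q, hq⟩
  · have h1 : q < 1 := by
      by_contra! hcon
      nlinarith
    have h2 : -2 < q := by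
      by_contra! hcon
      nlinarith
    rcases (by omega : q = -1 ∨ q = 0) with rfl | rfl <;> omega
  · have h1 : q < 2 := by
      by_contra! hcon
      nlinarith
    have h2 : -1 < q := by
      by_contra! hcon
      nlinarith
    rcases (by omega : q = 0 ∨ q = 1) with rfl | rfl <;> omega

theorem circularChromaticNumber_le {V : Type*} {G : SimpleGraph V} {k d : ℕ} (hd : 0 < d)
    (hk : 2 * d ≤ k) (h : HasCircularColoring G k d) :
    circularChromaticNumber G ≤ (k : ℝ) / d := by
  refine csInf_le ⟨0, ?_⟩ ⟨k, d, hd, hk, h, rfl⟩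
  rintro _ ⟨k, d, -, -, -, rfl⟩
  positivity

/-! ### The main result -/

theorem IsPlanar.comap {V V' : Type*} {G : SimpleGraph V} (h : IsPlanar G) (g : V' ↪ V) :
    IsPlanar (G.comap g) := by
  obtain ⟨D⟩ := h
  have hedge : ∀ e ∈ (G.comap g).edgeSet, Sym2.map g e ∈ G.edgeSet := by
    intro e he
    induction e with
    | _ x y => exact he
  refine ⟨⟨fun v => D.pt (g v), fun e => D.arc (Sym2.map g e),
    D.pt_injective.comp g.injective, fun u v huv => D.isPolygonalArc _ _ huv, ?_, ?_⟩⟩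
  · intro e he w hw
    have := D.mem_of_pt_mem _ (hedge e he) _ hw
    obtain ⟨w', hw', h⟩ := Sym2.mem_map.1 this
    rwa [← g.injective h]
  · intro e he e' he' hne z hz
    obtain ⟨w, hw, hw', rfl⟩ := D.inter_subset _ (hedge e he) _ (hedge e' he')
      (fun h => hne (Sym2.map.injective g.injective h)) z hz
    obtain ⟨x, hx, rfl⟩ := Sym2.mem_map.1 hw
    obtain ⟨y, hy, h⟩ := Sym2.mem_map.1 hw'
    exact ⟨x, hx, g.injective h ▸ hy, rfl⟩

/-- The infimum over natural numbers is attained when finite: without such an `m'` it would be at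
least `m + 1`. -/
theorem exists_isSteinbergBound {k m : ℕ} (h : f k ≤ (m : ℕ∞)) :
    ∃ m' ≤ m, IsSteinbergBound k m' := by
  by_contra! hcon
  have : ((m + 1 : ℕ) : ℕ∞) ≤ f k :=
    le_iInf₂ fun m' hm' => by
      have : m < m' := by
        by_contra! hle
        exact hcon m' hle hm'
      exact_mod_cast this
  have := this.trans h
  norm_cast at this
  omega

theorem cycleColorable_of_isSteinbergBound {V : Type} [Finite V] {G : SimpleGraph V} {a m : ℕ}
    (ha : 2 ≤ a) (hm : m < 4 * a * a) (hb : IsSteinbergBound (2 * a + 1) m) (hG : IsPlanar G)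
    (hgirth : ((4 * a : ℕ) : ℕ∞) ≤ G.egirth) : CycleColorable G (2 * a + 1) := by
  -- Without edges the replacement graph would be acyclic, not of girth exactly `2 * a + 1`; a
  -- constant map works then.
  rcases isEmpty_or_nonempty G.edgeSet with hE | ⟨⟨e₀⟩⟩
  · refine ⟨⟨fun _ => 0, fun {u v} huv => ?_⟩⟩
    exact (hE.false ⟨s(u, v), huv⟩).elim
  obtain ⟨D⟩ := hG
  have hex : ∀ e : G.edgeSet, ∃ u v, s(u, v) = e.1 := fun e => by
    obtain ⟨e, he⟩ := e
    induction e with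
    | _ x y => exact ⟨x, y, rfl⟩
  choose src tgt hst using hex
  have hst' : ∀ i : G.edgeSet × Bool, src i.1 ≠ tgt i.1 := fun i => by
    have := i.1.2
    rw [← hst i.1, SimpleGraph.mem_edgeSet] at this
    exact this.ne
  have hℓ : ∀ i : G.edgeSet × Bool, 2 ≤ pathLength a i := two_le_pathLength ha
  -- The longer of the two paths has `a + 1` edges, so each line needs at least that many segments.
  obtain ⟨N, r, hN, hD⟩ := D.exists_doubled hst (a + 1)
  have hplanar : IsPlanar (oddReplacement src tgt a) :=
    hD.isPlanar_subdivision hℓ (fun i => le_trans (by unfold pathLength; split_ifs <;> omega)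
      (hN i.1)) hst'
  have hlen : ∀ (x : _) (c : (oddReplacement src tgt a).Walk x x), c.IsCycle →
      c.length = 2 * a + 1 ∨ 4 * a * a ≤ c.length := fun x c hc =>
    length_eq_or_le_length ha hgirth hst hc
  refine cycleColorable_of_oddReplacement ha hst (hb _ _ hplanar (le_antisymm ?_ ?_) ?_)
  · obtain ⟨p, hp, hpl⟩ := exists_isPath_length_eq hℓ hst' (e₀, false)
    obtain ⟨q, hq, hql⟩ := exists_isPath_length_eq hℓ hst' (e₀, true)
    have hlt : pathLength a (e₀, true) = a + 1 := rfl
    have hlf : pathLength a (e₀, false) = a := rfl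
    -- Two distinct paths with the same ends yield a cycle of length at most `a + (a + 1)`, which
    -- bounds the girth from above.
    have hne : p ≠ q := fun h => by
      have := congrArg Walk.length h
      omega
    obtain ⟨w, -, -, c, hc, hcl⟩ := hp.exists_isCycle_length_le_add_of_ne hq hne
    refine (SimpleGraph.egirth_le_length hc).trans ?_
    exact_mod_cast (by omega : c.length ≤ 2 * a + 1)
  · rw [SimpleGraph.le_egirth]
    intro x c hc
    have : 2 * a + 1 ≤ c.length := by
      rcases hlen x c hc with h | h
      · exact h.ge
      · nlinarith
    exact_mod_cast this
  · intro x c hc hl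
    rcases hlen x c hc with h | h <;> omega

end SteinbergCircular

theorem proposition1p5 (p : ℕ) (hp : p.Prime) (hp5 : 5 ≤ p)
    (hf : SteinbergCircular.f p ≤ ((p * (p - 2) : ℕ) : ℕ∞))
    {V : Type*} [Finite V] (G : SimpleGraph V) (hG : SteinbergCircular.IsPlanar G)
    (hgirth : ((2 * p - 2 : ℕ) : ℕ∞) ≤ G.egirth) :
    SteinbergCircular.CycleColorable G p ∧
      SteinbergCircular.circularChromaticNumber G ≤ 2 + 2 / ((p : ℝ) - 1) := by
  obtain ⟨a, rfl⟩ : ∃ a, p = 2 * a + 1 := hp.odd_of_ne_two (by omega)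
  have ha : 2 ≤ a := by omega
  have hcol : SteinbergCircular.CycleColorable G (2 * a + 1) := by
    obtain ⟨m, hm, hb⟩ := SteinbergCircular.exists_isSteinbergBound hf
    -- Here `p * (p - 2) = (2 * a + 1) * (2 * a - 1) = 4 * a * a - 1`, just below the length of the
    -- long cycles.
    have hm' : m < 4 * a * a := by
      obtain ⟨b, rfl⟩ : ∃ b, a = b + 1 := ⟨a - 1, by omega⟩
      rw [show 2 * (b + 1) + 1 - 2 = 2 * b + 1 by omega] at hm
      nlinarith
    -- `IsSteinbergBound` speaks of graphs on types in `Type`, so `G` is carried over to `Fin n`.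
    obtain ⟨n, ⟨g⟩⟩ := Finite.exists_equiv_fin V
    let iso : G.comap g.symm ≃g G := SimpleGraph.Iso.comap g.symm G
    have hgirth' : ((4 * a : ℕ) : ℕ∞) ≤ (G.comap g.symm).egirth := by
      rw [iso.egirth_eq, show 4 * a = 2 * (2 * a + 1) - 2 by omega]
      exact hgirth
    obtain ⟨φ⟩ := SteinbergCircular.cycleColorable_of_isSteinbergBound ha hm' hb
      (hG.comap g.symm.toEmbedding) hgirth'
    exact ⟨φ.comp iso.symm.toHom⟩
  refine ⟨hcol, (SteinbergCircular.circularChromaticNumber_le (by omega) (by omega)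
    (hcol.hasCircularColoring (by omega))).trans_eq ?_⟩
  have : (a : ℝ) ≠ 0 := by positivity
  push_cast
  rw [add_sub_cancel_right]
  field_simp
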